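/- All manifolds are smooth, finite-dimensional, Hausdorff and without boundary, all Riemannian metrics are smooth, and a Riemannian metric $g$ has \emph{positive Ricci curvature} if $\mathrm{Ric}_g(v,v)>0$ for every nonzero tangent vector $v$. Let $G$ be a Lie group acting smoothly on a manifold $F$, and let $\pi:M\to B$ be a smooth fiber bundle with fiber $F$ and structure group $G$. That is, $M$ and $B$ are manifolds, and there are an open cover $(U_i)_{i\in I}$ of $B$, diffeomorphisms $\varphi_i:\pi^{-1}(U_i)\to U_i\times F$ whose first component is $\pi$, and smooth maps $\tau_{ij}:U_i\cap U_j\to G$ such that $\varphi_j\circ\varphi_i^{-1}(b,f)=(b,\tau_{ij}(b)\cdot f)$ for $b\in U_i\cap U_j$, $f\in F$, and $\tau_{jk}(b)\,\tau_{ij}(b)=\tau_{ik}(b)$ for $b\in U_i\cap U_j\cap U_k$. Suppose that the total space $M$ is compact and connected, and that 1. $B$ admits a Riemannian metric of positive Ricci curvature; 2. $F$ admits a $G$-invariant Riemannian metric of positive Ricci curvature. Then $M$ admits a Riemannian metric of positive Ricci curvature. -/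

import Mathlib

open scoped Manifold ContDiff

noncomputable section

set_option maxSynthPendingDepth 3

namespace PosRicci

/-! ### Ricci curvature of a metric on a vector space, in linear coordinates -/

section Coordinates

variable {E : Type*} [NormedAddCommGroup E] [NormedSpace ℝ E]

/-- Christoffel symbols of the first kind of the metric `G` at `y`:
`(v, w, z) ↦ ½ (∂_v G(w, z) + ∂_w G(v, z) - ∂_z G(v, w))`. -/
def koszulForm (G : E → E →L[ℝ] E →L[ℝ] ℝ) (y : E) : E →L[ℝ] E →L[ℝ] E →L[ℝ] ℝ :=
  let D : E →L[ℝ] E →L[ℝ] E →L[ℝ] ℝ := fderiv ℝ G y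
  let D' : E →L[ℝ] E →L[ℝ] E →L[ℝ] ℝ :=
    (ContinuousLinearMap.flipₗᵢ ℝ E E ℝ).toContinuousLinearEquiv.toContinuousLinearMap ∘L D.flip
  (1 / 2 : ℝ) • (D + D.flip - D')

theorem koszulForm_apply (G : E → E →L[ℝ] E →L[ℝ] ℝ) (y v w z : E) :
    koszulForm G y v w z =
      (1 / 2) * (fderiv ℝ G y v w z + fderiv ℝ G y w v z - fderiv ℝ G y z v w) := by
  simp [koszulForm]

/-- Christoffel symbols of the second kind: `Γ_y(v, w)` is the vector representing the functional
`koszulForm G y v w` with respect to `G y`, i.e. the Levi-Civita derivative `∇_v w` of the constant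
vector field `w`. -/
def christoffel (G : E → E →L[ℝ] E →L[ℝ] ℝ) (y : E) : E →L[ℝ] E →L[ℝ] E :=
  (ContinuousLinearMap.compL ℝ E (E →L[ℝ] ℝ) E (G y).inverse) ∘L koszulForm G y

theorem christoffel_apply (G : E → E →L[ℝ] E →L[ℝ] ℝ) (y v w : E) :
    christoffel G y v w = (G y).inverse (koszulForm G y v w) := rfl

/-- The endomorphism `u ↦ R(u, v) w`, where `R(u, v) w = ∇_u ∇_v w - ∇_v ∇_u w` for constant
vector fields `u`, `v`, `w`. -/
def curvatureEndo (G : E → E →L[ℝ] E →L[ℝ] ℝ) (y v w : E) : E →L[ℝ] E :=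
  ((fderiv ℝ (christoffel G) y).flip v).flip w - (fderiv ℝ (christoffel G) y v).flip w
    + (christoffel G y).flip (christoffel G y v w)
    - christoffel G y v ∘L (christoffel G y).flip w

theorem curvatureEndo_apply (G : E → E →L[ℝ] E →L[ℝ] ℝ) (y u v w : E) :
    curvatureEndo G y v w u =
      fderiv ℝ (christoffel G) y u v w - fderiv ℝ (christoffel G) y v u w
        + christoffel G y u (christoffel G y v w) - christoffel G y v (christoffel G y u w) := by
  simp [curvatureEndo]

/-- The Ricci tensor `Ric(v, w) = tr (u ↦ R(u, v) w)` of the metric `G` at `y`. -/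
def coordRicci (G : E → E →L[ℝ] E →L[ℝ] ℝ) (y v w : E) : ℝ :=
  LinearMap.trace ℝ E (curvatureEndo G y v w).toLinearMap

end Coordinates

/-! ### Riemannian metrics and positive Ricci curvature on manifolds -/

section Manifold

/-- Smooth Riemannian metrics on a manifold `M` without boundary modelled on `E`. -/
abbrev RiemMetric (E : Type*) [NormedAddCommGroup E] [NormedSpace ℝ E]
    (M : Type*) [TopologicalSpace M] [ChartedSpace E M] [IsManifold 𝓘(ℝ, E) ∞ M] :=
  Bundle.ContMDiffRiemannianMetric 𝓘(ℝ, E) ∞ E (fun x : M ↦ TangentSpace 𝓘(ℝ, E) x)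

variable {E : Type*} [NormedAddCommGroup E] [NormedSpace ℝ E]
  {M : Type*} [TopologicalSpace M] [ChartedSpace E M] [IsManifold 𝓘(ℝ, E) ∞ M]

/-- The metric `g` read in the preferred chart around `p`, i.e. its pullback under the inverse of
the chart. -/
def chartMetric (g : RiemMetric E M) (p : M) (y : E) : E →L[ℝ] E →L[ℝ] ℝ :=
  let A : E →L[ℝ] E := mfderiv 𝓘(ℝ, E) 𝓘(ℝ, E) (extChartAt 𝓘(ℝ, E) p).symm y
  let b : E →L[ℝ] E →L[ℝ] ℝ := g.inner ((extChartAt 𝓘(ℝ, E) p).symm y)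
  b.bilinearComp A A

theorem chartMetric_apply (g : RiemMetric E M) (p : M) (y v w : E) :
    chartMetric g p y v w = g.inner ((extChartAt 𝓘(ℝ, E) p).symm y)
      (mfderiv 𝓘(ℝ, E) 𝓘(ℝ, E) (extChartAt 𝓘(ℝ, E) p).symm y v)
      (mfderiv 𝓘(ℝ, E) 𝓘(ℝ, E) (extChartAt 𝓘(ℝ, E) p).symm y w) := rfl

/-- The Ricci tensor of `g` at `p`, computed in the preferred chart around `p`. -/
def ricci (g : RiemMetric E M) (p : M) (v w : TangentSpace 𝓘(ℝ, E) p) : ℝ :=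
  coordRicci (chartMetric g p) (extChartAt 𝓘(ℝ, E) p p)
    (mfderiv 𝓘(ℝ, E) 𝓘(ℝ, E) (extChartAt 𝓘(ℝ, E) p) p v)
    (mfderiv 𝓘(ℝ, E) 𝓘(ℝ, E) (extChartAt 𝓘(ℝ, E) p) p w)

/-- `g` has positive Ricci curvature. -/
def HasPositiveRicci (g : RiemMetric E M) : Prop :=
  ∀ (p : M) (v : TangentSpace 𝓘(ℝ, E) p), v ≠ 0 → 0 < ricci g p v v

/-- `g` is invariant under the action of `G`: every element of `G` acts by an isometry. -/
def IsInvariantMetric (G : Type*) [SMul G M] (g : RiemMetric E M) : Prop :=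
  ∀ (a : G) (x : M) (v w : TangentSpace 𝓘(ℝ, E) x),
    g.inner (a • x) (mfderiv 𝓘(ℝ, E) 𝓘(ℝ, E) (fun y : M ↦ a • y) x v)
      (mfderiv 𝓘(ℝ, E) 𝓘(ℝ, E) (fun y : M ↦ a • y) x w) = g.inner x v w

end Manifold

/-! ### Smooth fibre bundles with structure group -/

/-- The structure on `π : M → B` of a smooth fibre bundle with fibre `F` and structure group `G`:
smooth local trivializations over an open cover of `B`, whose transition maps are given by a
smooth cocycle with values in `G`, acting on `F`. -/
structure FiberBundleWithGroup (EM EB EF EG : Type*)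
    [NormedAddCommGroup EM] [NormedSpace ℝ EM] [NormedAddCommGroup EB] [NormedSpace ℝ EB]
    [NormedAddCommGroup EF] [NormedSpace ℝ EF] [NormedAddCommGroup EG] [NormedSpace ℝ EG]
    {M B : Type*} (F G : Type*)
    [TopologicalSpace M] [ChartedSpace EM M] [TopologicalSpace B] [ChartedSpace EB B]
    [TopologicalSpace F] [ChartedSpace EF F] [TopologicalSpace G] [ChartedSpace EG G]
    [Group G] [MulAction G F] (ι : Type*) (π : M → B) where
  /-- the local trivializations -/
  triv : ι → Bundle.Trivialization F π
  /-- the transition functions -/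
  transition : ι → ι → B → G
  cover : ∀ b : B, ∃ i, b ∈ (triv i).baseSet
  contMDiffOn_triv : ∀ i, ContMDiffOn 𝓘(ℝ, EM) (𝓘(ℝ, EB).prod 𝓘(ℝ, EF)) ∞
    (triv i) (triv i).source
  contMDiffOn_triv_symm : ∀ i, ContMDiffOn (𝓘(ℝ, EB).prod 𝓘(ℝ, EF)) 𝓘(ℝ, EM) ∞
    (triv i).toOpenPartialHomeomorph.symm (triv i).target
  contMDiffOn_transition : ∀ i j, ContMDiffOn 𝓘(ℝ, EB) 𝓘(ℝ, EG) ∞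
    (transition i j) ((triv i).baseSet ∩ (triv j).baseSet)
  coordChange_eq : ∀ i j, ∀ b ∈ (triv i).baseSet ∩ (triv j).baseSet, ∀ f : F,
    (triv i).coordChange (triv j) b f = transition i j b • f
  cocycle : ∀ i j k, ∀ b ∈ (triv i).baseSet ∩ (triv j).baseSet ∩ (triv k).baseSet,
    transition j k b * transition i j b = transition i k b

end PosRicci

end

open scoped Manifold ContDiff

set_option maxSynthPendingDepth 3

noncomputable section

/-! The transition functions act on the fibre by isometries. Averaging the flat connections of the
local trivializations with a partition of unity on the base therefore gives a connection on `M`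
whose form `ξ`, in a trivialization, takes values in Killing fields of the fibre metric. For s > 0
let g_s be the metric that is g_B on horizontal vectors and s · g_F on vertical ones, with the two
orthogonal. For small s it has positive Ricci curvature.

In product coordinates the inverse of g_s is g_B⁻¹ on the horizontal part plus s⁻¹ g_F⁻¹ on the
vertical part, while the Christoffel symbols of the first kind are K_B + s K_F. Since K_B
annihilates vertical vectors, the factor s⁻¹ meets only s K_F, and the symbols of the second kind
are exactly Γ₀ + s Γ₁ (`christoffel_connMetric`). So the metrics degenerate as s → 0, but their
connections converge together with derivatives, and the Ricci tensor, which depends on the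
connection alone, extends continuously to s = 0.

The connection Γ₀ projects to the Levi-Civita connection of the base. Killing fields are
infinitesimal affine transformations (`killing_christoffel`), and this makes the vertical block of U
↦ R₀(U, X)X equal to the one of the fibre, evaluated at the vertical part of X. Taking traces,
Ric₀(X, X) is the sum of the base Ricci tensor on the projection of X and the fibre Ricci tensor on
its vertical part (`connRicci_limitConn`), which is positive for X ≠ 0. Compactness of the unit
sphere gives a bound on s near each point (`coordRicci_connMetric_pos`), and compactness of `M` a
single one.

The rest transfers this to manifolds: the Ricci tensor is natural (`IsPullbackAt.coordRicci_eq`),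
the averaged connection has a Killing form in charts (`isKillingForm_gaugeForm`,
`gaugeMap_isometry`), and by invariance of the fibre metric g_s does not depend on the
trivialization (`connForm_eq`). -/

namespace PosRicci

open Filter Topology

/-! ### Calculus for families of linear maps -/

section Calculus

variable {D E F : Type*} [NormedAddCommGroup D] [NormedSpace ℝ D]
  [NormedAddCommGroup E] [NormedSpace ℝ E] [NormedAddCommGroup F] [NormedSpace ℝ F]

/-- In finite dimension, smoothness of a family of linear maps can be checked pointwise. -/
theorem contDiffAt_clm_of_apply [FiniteDimensional ℝ E] {n : WithTop ℕ∞} {f : D → E →L[ℝ] F} {x : D}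
    (h : ∀ v, ContDiffAt ℝ n (fun z ↦ f z v) x) : ContDiffAt ℝ n f x := by
  let d := Module.finrank ℝ E
  have hd : d = Module.finrank ℝ (Fin d → ℝ) := (Module.finrank_fin_fun ℝ).symm
  let e₁ := ContinuousLinearEquiv.ofFinrankEq hd
  let e₂ := (e₁.arrowCongr (1 : F ≃L[ℝ] F)).trans (ContinuousLinearEquiv.piRing (Fin d))
  rw [← Function.id_comp f, ← e₂.symm_comp_self]
  exact e₂.symm.contDiff.contDiffAt.comp x (contDiffAt_pi.mpr fun i ↦ h _)

theorem contDiffAt_bilin_of_apply [FiniteDimensional ℝ E] {n : WithTop ℕ∞}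
    {f : D → E →L[ℝ] E →L[ℝ] F} {x : D}
    (h : ∀ v w, ContDiffAt ℝ n (fun z ↦ f z v w) x) : ContDiffAt ℝ n f x :=
  contDiffAt_clm_of_apply fun v ↦ contDiffAt_clm_of_apply fun w ↦ h v w

theorem hasFDerivAt_clm_apply_const {A : D → E →L[ℝ] F} {x : D} (hA : DifferentiableAt ℝ A x)
    (v : E) : HasFDerivAt (fun z ↦ A z v) ((fderiv ℝ A x).flip v) x := by
  simpa using hA.hasFDerivAt.clm_apply (hasFDerivAt_const v x)

theorem fderiv_clm_apply_const {A : D → E →L[ℝ] F} {x : D} (hA : DifferentiableAt ℝ A x)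
    (u : D) (v : E) : fderiv ℝ (fun z ↦ A z v) x u = fderiv ℝ A x u v := by
  rw [(hasFDerivAt_clm_apply_const hA v).fderiv]; rfl

theorem isSymmSndFDerivAt_of_contDiffAt {f : E → F} {x : E} (h : ContDiffAt ℝ 2 f x) :
    IsSymmSndFDerivAt ℝ f x :=
  h.isSymmSndFDerivAt (by simp)

end Calculus

/-! ### Curvature of a linear connection and change of coordinates -/

section Connection

variable {E E' : Type*} [NormedAddCommGroup E] [NormedSpace ℝ E]
  [NormedAddCommGroup E'] [NormedSpace ℝ E']

/-- The endomorphism `u ↦ R(u, v) w` of a linear connection with Christoffel symbols `Γ`. -/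
def connCurv (Γ : E → E →L[ℝ] E →L[ℝ] E) (y v w : E) : E →L[ℝ] E :=
  ((fderiv ℝ Γ y).flip v).flip w - (fderiv ℝ Γ y v).flip w
    + (Γ y).flip (Γ y v w) - Γ y v ∘L (Γ y).flip w

theorem connCurv_apply (Γ : E → E →L[ℝ] E →L[ℝ] E) (y u v w : E) :
    connCurv Γ y v w u = fderiv ℝ Γ y u v w - fderiv ℝ Γ y v u w
        + Γ y u (Γ y v w) - Γ y v (Γ y u w) := by
  simp [connCurv]

/-- The Ricci tensor of a linear connection with Christoffel symbols `Γ`. -/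
def connRicci (Γ : E → E →L[ℝ] E →L[ℝ] E) (y v w : E) : ℝ :=
  LinearMap.trace ℝ E (connCurv Γ y v w).toLinearMap

theorem coordRicci_eq_connRicci (G : E → E →L[ℝ] E →L[ℝ] ℝ) (y v w : E) :
    coordRicci G y v w = connRicci (christoffel G) y v w := rfl

/-- The hypothesis `h` is the inhomogeneous transformation law of Christoffel symbols.
Differentiating it and antisymmetrizing in `u`, `v` removes the derivatives of `φ` of order two and
three, by their symmetry. Invertibility of the derivative plays no role until the trace is taken. -/
theorem connCurv_map {φ : E → E'} {Γ : E → E →L[ℝ] E →L[ℝ] E} {Γ' : E' → E' →L[ℝ] E' →L[ℝ] E'}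
    {y : E} (hφ : ContDiffAt ℝ 3 φ y) (hΓ : DifferentiableAt ℝ Γ y)
    (hΓ' : DifferentiableAt ℝ Γ' (φ y))
    (h : ∀ᶠ z in 𝓝 y, ∀ v w, fderiv ℝ φ z (Γ z v w) =
      fderiv ℝ (fderiv ℝ φ) z v w + Γ' (φ z) (fderiv ℝ φ z v) (fderiv ℝ φ z w)) (u v w : E) :
    fderiv ℝ φ y (connCurv Γ y v w u) =
      connCurv Γ' (φ y) (fderiv ℝ φ y v) (fderiv ℝ φ y w) (fderiv ℝ φ y u) := by
  have hφ1 : ContDiffAt ℝ 2 (fderiv ℝ φ) y := hφ.fderiv_right (by norm_num)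
  have hφ2 : ContDiffAt ℝ 1 (fderiv ℝ (fderiv ℝ φ)) y := hφ1.fderiv_right (by norm_num)
  have d0 := (hφ.differentiableAt (by norm_num)).hasFDerivAt
  have d1 := (hφ1.differentiableAt (by norm_num)).hasFDerivAt
  have d2 := (hφ2.differentiableAt (by norm_num))
  have s1 := isSymmSndFDerivAt_of_contDiffAt (hφ.of_le (by norm_num))
  have s2 := isSymmSndFDerivAt_of_contDiffAt hφ1
  -- The transformation law, differentiated in the direction `u`.
  have key : ∀ u v w, fderiv ℝ (fderiv ℝ φ) y u (Γ y v w) + fderiv ℝ φ y (fderiv ℝ Γ y u v w) =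
      fderiv ℝ (fderiv ℝ (fderiv ℝ φ)) y u v w
      + (fderiv ℝ Γ' (φ y) (fderiv ℝ φ y u) (fderiv ℝ φ y v) (fderiv ℝ φ y w)
      + Γ' (φ y) (fderiv ℝ (fderiv ℝ φ) y u v) (fderiv ℝ φ y w)
      + Γ' (φ y) (fderiv ℝ φ y v) (fderiv ℝ (fderiv ℝ φ) y u w)) := by
    intro u v w
    have a1 := d1.clm_apply ((hasFDerivAt_clm_apply_const hΓ v).clm_apply (hasFDerivAt_const w y))
    have dv := d1.clm_apply (hasFDerivAt_const v y)
    have dw := d1.clm_apply (hasFDerivAt_const w y)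
    have a2 := ((hasFDerivAt_clm_apply_const d2 v).clm_apply (hasFDerivAt_const w y)).add
      (((hΓ'.hasFDerivAt.comp y d0).clm_apply dv).clm_apply dw)
    have a3 := a1.congr_of_eventuallyEq (f₁ := fun z ↦ fderiv ℝ (fderiv ℝ φ) z v w +
      Γ' (φ z) (fderiv ℝ φ z v) (fderiv ℝ φ z w)) (h.mono fun z hz ↦ (hz v w).symm)
    have := DFunLike.congr_fun (a3.unique a2) u
    simp at this
    rw [add_comm, this]
    abel
  have h0 := h.self_of_nhds
  have k1 := key u v w
  have k2 := key v u w
  rw [connCurv_apply, connCurv_apply]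
  simp only [map_add, map_sub, h0]
  -- After this exchange the third derivative and the term with the second derivative in `u`, `v`
  -- are identical in `k1` and `k2`, so they cancel in the difference.
  rw [s2.eq v u, s1.eq v u] at k2
  have e1 := eq_sub_of_add_eq' k1
  have e2 := eq_sub_of_add_eq' k2
  rw [e1, e2]
  abel

theorem connRicci_map [FiniteDimensional ℝ E] [FiniteDimensional ℝ E']
    {φ : E → E'} {Γ : E → E →L[ℝ] E →L[ℝ] E} {Γ' : E' → E' →L[ℝ] E' →L[ℝ] E'}
    {y : E} (hφ : ContDiffAt ℝ 3 φ y) (hφi : (fderiv ℝ φ y).IsInvertible)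
    (hΓ : DifferentiableAt ℝ Γ y) (hΓ' : DifferentiableAt ℝ Γ' (φ y))
    (h : ∀ᶠ z in 𝓝 y, ∀ v w, fderiv ℝ φ z (Γ z v w) =
      fderiv ℝ (fderiv ℝ φ) z v w + Γ' (φ z) (fderiv ℝ φ z v) (fderiv ℝ φ z w)) (v w : E) :
    connRicci Γ y v w = connRicci Γ' (φ y) (fderiv ℝ φ y v) (fderiv ℝ φ y w) := by
  have key := connCurv_map hφ hΓ hΓ' h
  obtain ⟨L, hL⟩ := hφi
  unfold connRicci
  rw [← LinearMap.trace_conj' _ L.toLinearEquiv]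
  congr 1
  ext x
  obtain ⟨u, rfl⟩ := L.surjective x
  have := key u v w
  rw [← hL] at this
  simpa [LinearEquiv.conj_apply, ← hL] using this

end Connection

/-! ### The Levi-Civita connection in coordinates and its naturality -/

section Metric

variable {E E' : Type*} [NormedAddCommGroup E] [NormedSpace ℝ E]
  [NormedAddCommGroup E'] [NormedSpace ℝ E']

/-- A bounded bilinear form which is symmetric and positive definite. -/
structure IsInnerForm (b : E →L[ℝ] E →L[ℝ] ℝ) : Prop where
  symm : ∀ v w, b v w = b w v
  pos : ∀ v, v ≠ 0 → 0 < b v v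

theorem IsInnerForm.eq_of_forall {b : E →L[ℝ] E →L[ℝ] ℝ} (hb : IsInnerForm b) {v w : E}
    (h : ∀ z, b v z = b w z) : v = w := by
  by_contra hne
  have h1 := hb.pos (v - w) (sub_ne_zero.mpr hne)
  have h2 : b (v - w) (v - w) = 0 := by
    rw [map_sub b, sub_apply, h, sub_self]
  exact h1.ne' h2

theorem IsInnerForm.isInvertible [FiniteDimensional ℝ E] {b : E →L[ℝ] E →L[ℝ] ℝ}
    (hb : IsInnerForm b) : b.IsInvertible := by
  have hinj : Function.Injective b.toLinearMap := fun v w h ↦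
    hb.eq_of_forall fun z ↦ DFunLike.congr_fun (show b v = b w from h) z
  have hfr : Module.finrank ℝ E = Module.finrank ℝ (E →L[ℝ] ℝ) := by
    rw [← LinearEquiv.finrank_eq (LinearMap.toContinuousLinearMap (𝕜 := ℝ) (E := E) (F' := ℝ))]
    exact (Subspace.dual_finrank_eq (K := ℝ) (V := E)).symm
  refine ⟨(LinearMap.linearEquivOfInjective _ hinj hfr).toContinuousLinearEquiv, ?_⟩
  ext; rfl

theorem inner_christoffel [FiniteDimensional ℝ E] {G : E → E →L[ℝ] E →L[ℝ] ℝ} {y : E}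
    (hG : IsInnerForm (G y)) (v w z : E) :
    G y (christoffel G y v w) z = koszulForm G y v w z := by
  rw [christoffel_apply, hG.isInvertible.self_apply_inverse]

theorem christoffel_eq_iff [FiniteDimensional ℝ E] {G : E → E →L[ℝ] E →L[ℝ] ℝ} {y : E}
    (hG : IsInnerForm (G y)) {v w x : E} :
    christoffel G y v w = x ↔ ∀ z, G y x z = koszulForm G y v w z := by
  constructor
  · rintro rfl z
    exact inner_christoffel hG v w z
  · intro h
    exact hG.eq_of_forall fun z ↦ by rw [h, inner_christoffel hG]

theorem fderiv_symm {G : E → E →L[ℝ] E →L[ℝ] ℝ} {y : E} (hd : DifferentiableAt ℝ G y)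
    (hG : ∀ᶠ z in 𝓝 y, ∀ v w, G z v w = G z w v) (u v w : E) :
    fderiv ℝ G y u v w = fderiv ℝ G y u w v := by
  have a (v w : E) := (hasFDerivAt_clm_apply_const hd v).clm_apply (hasFDerivAt_const w y)
  have := DFunLike.congr_fun ((a v w).unique ((a w v).congr_of_eventuallyEq
    (f₁ := fun z ↦ G z v w) (hG.mono fun z hz ↦ hz v w))) u
  simpa using this

theorem koszulForm_symm {G : E → E →L[ℝ] E →L[ℝ] ℝ} {y : E} (hd : DifferentiableAt ℝ G y)
    (hG : ∀ᶠ z in 𝓝 y, ∀ v w, G z v w = G z w v) (v w : E) :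
    koszulForm G y v w = koszulForm G y w v := by
  ext z
  rw [koszulForm_apply, koszulForm_apply, fderiv_symm hd hG z v w]
  ring

theorem christoffel_symm {G : E → E →L[ℝ] E →L[ℝ] ℝ} {y : E} (hd : DifferentiableAt ℝ G y)
    (hG : ∀ᶠ z in 𝓝 y, ∀ v w, G z v w = G z w v) (v w : E) :
    christoffel G y v w = christoffel G y w v := by
  rw [christoffel_apply, christoffel_apply, koszulForm_symm hd hG]

theorem contDiffAt_koszulForm [FiniteDimensional ℝ E] {G : E → E →L[ℝ] E →L[ℝ] ℝ} {y : E}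
    {m n : WithTop ℕ∞} (h : ContDiffAt ℝ n G y) (hmn : m + 1 ≤ n) :
    ContDiffAt ℝ m (koszulForm G) y := by
  have h1 : ContDiffAt ℝ m (fderiv ℝ G) y := h.fderiv_right hmn
  refine contDiffAt_clm_of_apply fun u ↦ contDiffAt_bilin_of_apply fun v w ↦ ?_
  simp only [koszulForm_apply]
  fun_prop

theorem contDiffAt_inverse_form [FiniteDimensional ℝ E] {H : E' → E →L[ℝ] E →L[ℝ] ℝ} {y : E'}
    {n : WithTop ℕ∞} (h : ContDiffAt ℝ n H y) (hH : IsInnerForm (H y)) :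
    ContDiffAt ℝ n (fun z ↦ (H z).inverse) y :=
  (hH.isInvertible.contDiffAt_map_inverse).comp y h

theorem contDiffAt_christoffel [FiniteDimensional ℝ E] {G : E → E →L[ℝ] E →L[ℝ] ℝ} {y : E}
    {m n : WithTop ℕ∞} (h : ContDiffAt ℝ n G y) (hmn : m + 1 ≤ n) (hG : IsInnerForm (G y)) :
    ContDiffAt ℝ m (christoffel G) y := by
  have h1 := contDiffAt_koszulForm h hmn
  have h2 := contDiffAt_inverse_form (h.of_le (le_self_add.trans hmn)) hG
  refine contDiffAt_bilin_of_apply fun v w ↦ ?_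
  simp only [christoffel_apply]
  fun_prop

/-- `G` is the pull-back of `G'` under `φ`, near `y`. -/
def IsPullbackAt (φ : E → E') (G : E → E →L[ℝ] E →L[ℝ] ℝ) (G' : E' → E' →L[ℝ] E' →L[ℝ] ℝ)
    (y : E) : Prop :=
  ∀ᶠ z in 𝓝 y, ∀ v w, G z v w = G' (φ z) (fderiv ℝ φ z v) (fderiv ℝ φ z w)

theorem IsPullbackAt.fderiv_eq {φ : E → E'} {G : E → E →L[ℝ] E →L[ℝ] ℝ}
    {G' : E' → E' →L[ℝ] E' →L[ℝ] ℝ} {y : E} (h : IsPullbackAt φ G G' y)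
    (hφ : ContDiffAt ℝ 2 φ y) (hG : DifferentiableAt ℝ G y) (hG' : DifferentiableAt ℝ G' (φ y))
    (u v w : E) :
    fderiv ℝ G y u v w =
      fderiv ℝ G' (φ y) (fderiv ℝ φ y u) (fderiv ℝ φ y v) (fderiv ℝ φ y w)
      + G' (φ y) (fderiv ℝ (fderiv ℝ φ) y u v) (fderiv ℝ φ y w)
      + G' (φ y) (fderiv ℝ φ y v) (fderiv ℝ (fderiv ℝ φ) y u w) := by
  have d0 := (hφ.differentiableAt (by norm_num)).hasFDerivAt
  have hφ1 : ContDiffAt ℝ 1 (fderiv ℝ φ) y := hφ.fderiv_right (by norm_num)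
  have d1 := (hφ1.differentiableAt (by norm_num)).hasFDerivAt
  have a1 := (hasFDerivAt_clm_apply_const hG v).clm_apply (hasFDerivAt_const w y)
  have a2 := ((hG'.hasFDerivAt.comp y d0).clm_apply (d1.clm_apply (hasFDerivAt_const v y))).clm_apply
    (d1.clm_apply (hasFDerivAt_const w y))
  have a3 := a2.congr_of_eventuallyEq (f₁ := fun z ↦ G z v w) (h.mono fun z hz ↦ hz v w)
  have := DFunLike.congr_fun (a1.unique a3) u
  simp at this
  rw [this]
  ring

/-- The three derivatives of the metric produce six terms with a second derivative of `φ`. By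
symmetry four of them cancel, and the remaining two are equal; with the factor ½ they form the
inhomogeneous term. -/
theorem IsPullbackAt.koszulForm_eq {φ : E → E'} {G : E → E →L[ℝ] E →L[ℝ] ℝ}
    {G' : E' → E' →L[ℝ] E' →L[ℝ] ℝ} {y : E} (h : IsPullbackAt φ G G' y)
    (hφ : ContDiffAt ℝ 2 φ y) (hG : DifferentiableAt ℝ G y) (hG' : DifferentiableAt ℝ G' (φ y))
    (hsymm : ∀ v w, G' (φ y) v w = G' (φ y) w v) (v w z : E) :
    koszulForm G y v w z =
      koszulForm G' (φ y) (fderiv ℝ φ y v) (fderiv ℝ φ y w) (fderiv ℝ φ y z)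
      + G' (φ y) (fderiv ℝ (fderiv ℝ φ) y v w) (fderiv ℝ φ y z) := by
  have s1 := isSymmSndFDerivAt_of_contDiffAt hφ
  rw [koszulForm_apply, koszulForm_apply]
  simp only [h.fderiv_eq hφ hG hG']
  rw [s1.eq w v, s1.eq w z, s1.eq v z, hsymm (fderiv ℝ φ y v), hsymm (fderiv ℝ φ y w)]
  ring

/-- This is the transformation law required by `connRicci_map`. -/
theorem IsPullbackAt.christoffel_eq [FiniteDimensional ℝ E] [FiniteDimensional ℝ E']
    {φ : E → E'} {G : E → E →L[ℝ] E →L[ℝ] ℝ}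
    {G' : E' → E' →L[ℝ] E' →L[ℝ] ℝ} {y : E} (h : IsPullbackAt φ G G' y)
    (hφ : ContDiffAt ℝ 2 φ y) (hφi : (fderiv ℝ φ y).IsInvertible)
    (hG : DifferentiableAt ℝ G y) (hG' : DifferentiableAt ℝ G' (φ y))
    (hin : IsInnerForm (G y)) (hin' : IsInnerForm (G' (φ y))) (v w : E) :
    fderiv ℝ φ y (christoffel G y v w) = fderiv ℝ (fderiv ℝ φ) y v w +
      christoffel G' (φ y) (fderiv ℝ φ y v) (fderiv ℝ φ y w) := by
  refine hin'.eq_of_forall fun x ↦ ?_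
  obtain ⟨z, rfl⟩ := hφi.surjective x
  rw [← h.self_of_nhds, inner_christoffel hin, h.koszulForm_eq hφ hG hG' hin'.symm, map_add,
    add_apply, inner_christoffel hin', add_comm]

theorem IsPullbackAt.isInnerForm {φ : E → E'} {G : E → E →L[ℝ] E →L[ℝ] ℝ}
    {G' : E' → E' →L[ℝ] E' →L[ℝ] ℝ} {y : E} (h : IsPullbackAt φ G G' y)
    (hφi : (fderiv ℝ φ y).IsInvertible) (hin' : IsInnerForm (G' (φ y))) : IsInnerForm (G y) where
  symm v w := by rw [h.self_of_nhds, h.self_of_nhds, hin'.symm]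
  pos v hv := by
    rw [h.self_of_nhds]
    exact hin'.pos _ fun h0 ↦ hv (hφi.injective (by rw [h0, map_zero]))

theorem IsPullbackAt.contDiffAt [FiniteDimensional ℝ E]
    {φ : E → E'} {G : E → E →L[ℝ] E →L[ℝ] ℝ}
    {G' : E' → E' →L[ℝ] E' →L[ℝ] ℝ} {y : E} (h : IsPullbackAt φ G G' y) {n m : WithTop ℕ∞}
    (hφ : ContDiffAt ℝ n φ y) (hG' : ContDiffAt ℝ m G' (φ y)) (hmn : m + 1 ≤ n) :
    ContDiffAt ℝ m G y := by
  have hφ1 : ContDiffAt ℝ m (fderiv ℝ φ) y := hφ.fderiv_right hmn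
  have h2 : ContDiffAt ℝ m (fun z ↦ G' (φ z)) y := hG'.comp y (hφ.of_le (le_self_add.trans hmn))
  refine contDiffAt_bilin_of_apply fun v w ↦ ?_
  refine ContDiffAt.congr_of_eventuallyEq ?_ (h.mono fun z hz ↦ hz v w)
  exact (h2.clm_apply (hφ1.clm_apply contDiffAt_const)).clm_apply
    (hφ1.clm_apply contDiffAt_const)

/-- The Ricci tensor is invariant under local diffeomorphisms. -/
theorem IsPullbackAt.coordRicci_eq [FiniteDimensional ℝ E] [FiniteDimensional ℝ E']
    {φ : E → E'} {G : E → E →L[ℝ] E →L[ℝ] ℝ}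
    {G' : E' → E' →L[ℝ] E' →L[ℝ] ℝ} {y : E} (h : IsPullbackAt φ G G' y)
    (hφ : ContDiffAt ℝ 3 φ y) (hφi : (fderiv ℝ φ y).IsInvertible)
    (hG' : ContDiffAt ℝ 2 G' (φ y)) (hin' : ∀ᶠ z in 𝓝 (φ y), IsInnerForm (G' z)) (v w : E) :
    coordRicci G y v w = coordRicci G' (φ y) (fderiv ℝ φ y v) (fderiv ℝ φ y w) := by
  have hG2 : ContDiffAt ℝ 2 G y := h.contDiffAt hφ hG' (by norm_num)
  have hcφ := hφ.continuousAt
  rw [coordRicci_eq_connRicci, coordRicci_eq_connRicci]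
  -- The transformation law is differentiated in `connRicci_map`, so it is needed on a neighbourhood
  -- of `y`. Invertibility of the derivative persists there because invertible operators form an
  -- open set.
  have hinv : ∀ᶠ z in 𝓝 y, (fderiv ℝ φ z).IsInvertible := by
    obtain ⟨L, hL⟩ := hφi
    have hc : ContinuousAt (fderiv ℝ φ) y :=
      (hφ.fderiv_right (m := 0) (by simp)).continuousAt
    have := hc.preimage_mem_nhds (t := Set.range ((↑) : (E ≃L[ℝ] E') → E →L[ℝ] E')) (by
      rw [← hL]; exact ContinuousLinearEquiv.nhds L)
    filter_upwards [this] with z hz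
    obtain ⟨L', hL'⟩ := hz
    exact ⟨L', hL'⟩
  refine connRicci_map hφ hφi
    ((contDiffAt_christoffel (m := 1) hG2 (by norm_num)
      (h.isInnerForm hφi hin'.self_of_nhds)).differentiableAt (by norm_num))
    ((contDiffAt_christoffel (m := 1) hG' (by norm_num)
      hin'.self_of_nhds).differentiableAt (by norm_num)) ?_ v w
  filter_upwards [h.eventually_nhds, hcφ.eventually hin', hinv, hφ.eventually (by simp),
    hG2.eventually (by simp), hcφ.eventually (hG'.eventually (by simp))]
    with z hz hz' hzi hzφ hzG hzG' v w
  exact IsPullbackAt.christoffel_eq hz (hzφ.of_le (by norm_num)) hzi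
    (hzG.differentiableAt (by norm_num)) (hzG'.differentiableAt (by norm_num))
    (IsPullbackAt.isInnerForm hz hzi hz') hz' v w

end Metric

/-! ### Killing fields preserve the Levi-Civita connection -/

section Killing

variable {E : Type*} [NormedAddCommGroup E] [NormedSpace ℝ E]

/-- A Killing vector field is an infinitesimal affine transformation of the Levi-Civita
connection. -/
theorem killing_christoffel [FiniteDimensional ℝ E] {G : E → E →L[ℝ] E →L[ℝ] ℝ} {ξ : E → E} {y : E}
    (hG : ContDiffAt ℝ 2 G y) (hξ : ContDiffAt ℝ 2 ξ y) (hin : ∀ᶠ z in 𝓝 y, IsInnerForm (G z))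
    (hK : ∀ᶠ z in 𝓝 y, ∀ v w, fderiv ℝ G z (ξ z) v w + G z (fderiv ℝ ξ z v) w
      + G z v (fderiv ℝ ξ z w) = 0) (u w : E) :
    fderiv ℝ (fderiv ℝ ξ) y u w + fderiv ℝ (christoffel G) y (ξ y) u w
      + christoffel G y (fderiv ℝ ξ y u) w + christoffel G y u (fderiv ℝ ξ y w)
      - fderiv ℝ ξ y (christoffel G y u w) = 0 := by
  have hG1 : ContDiffAt ℝ 1 (fderiv ℝ G) y := hG.fderiv_right (by norm_num)
  have hξ1 : ContDiffAt ℝ 1 (fderiv ℝ ξ) y := hξ.fderiv_right (by norm_num)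
  have dG := hG.differentiableAt (by norm_num)
  have dξ := (hξ.differentiableAt (by norm_num)).hasFDerivAt
  have dG1 := hG1.differentiableAt (by norm_num)
  have dξ1 := hξ1.differentiableAt (by norm_num)
  have sG := isSymmSndFDerivAt_of_contDiffAt hG
  have sξ := isSymmSndFDerivAt_of_contDiffAt hξ
  have hsym : ∀ᶠ z in 𝓝 y, ∀ v w, G z v w = G z w v := hin.mono fun z hz ↦ hz.symm
  have dΓ : DifferentiableAt ℝ (christoffel G) y :=
    (contDiffAt_christoffel (m := 1) hG (by norm_num) hin.self_of_nhds).differentiableAt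
      (by norm_num)
  have hin0 := hin.self_of_nhds
  have hK0 := hK.self_of_nhds
  have D2sym : ∀ a u v w : E, fderiv ℝ (fderiv ℝ G) y a u v w = fderiv ℝ (fderiv ℝ G) y a u w v := by
    intro a u v w
    have h1 : ∀ᶠ z in 𝓝 y, ∀ v w, fderiv ℝ G z u v w = fderiv ℝ G z u w v := by
      filter_upwards [hsym.eventually_nhds, hG.eventually (by simp)] with z hz hz' v w
      exact fderiv_symm (hz'.differentiableAt (by norm_num)) hz u v w
    have h2 := fderiv_symm (hasFDerivAt_clm_apply_const dG1 u).differentiableAt h1 a v w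
    rwa [fderiv_clm_apply_const dG1] at h2
  -- the derivative of the Killing equation
  have key : ∀ a v w : E,
      fderiv ℝ (fderiv ℝ G) y a (ξ y) v w + fderiv ℝ G y (fderiv ℝ ξ y a) v w
      + (fderiv ℝ G y a (fderiv ℝ ξ y v) w + G y (fderiv ℝ (fderiv ℝ ξ) y a v) w)
      + (fderiv ℝ G y a v (fderiv ℝ ξ y w) + G y v (fderiv ℝ (fderiv ℝ ξ) y a w)) = 0 := by
    intro a v w
    have c (x : E) := hasFDerivAt_const (𝕜 := ℝ) x y
    have a1 := ((dG1.hasFDerivAt.clm_apply dξ).clm_apply (c v)).clm_apply (c w)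
    have a2 := (dG.hasFDerivAt.clm_apply (hasFDerivAt_clm_apply_const dξ1 v)).clm_apply (c w)
    have a3 := (hasFDerivAt_clm_apply_const dG v).clm_apply (hasFDerivAt_clm_apply_const dξ1 w)
    have a4 := ((a1.add a2).add a3).congr_of_eventuallyEq (f₁ := fun _ ↦ (0 : ℝ))
      (hK.mono fun z hz ↦ (hz v w).symm)
    have := DFunLike.congr_fun (a4.unique (hasFDerivAt_const 0 y)) a
    simp at this
    linarith
  -- the derivative of the defining equation of the Christoffel symbols
  have dK : ∀ a u w z : E, fderiv ℝ G y a (christoffel G y u w) z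
      + G y (fderiv ℝ (christoffel G) y a u w) z = (1 / 2) * (fderiv ℝ (fderiv ℝ G) y a u w z
      + fderiv ℝ (fderiv ℝ G) y a w u z - fderiv ℝ (fderiv ℝ G) y a z u w) := by
    intro a u w z
    have c (x : E) := hasFDerivAt_const (𝕜 := ℝ) x y
    have b1 := (dG.hasFDerivAt.clm_apply
      ((hasFDerivAt_clm_apply_const dΓ u).clm_apply (c w))).clm_apply (c z)
    have t (u v w : E) := ((hasFDerivAt_clm_apply_const dG1 u).clm_apply (c v)).clm_apply (c w)
    have b2 := (((t u w z).add (t w u z)).sub (t z u w)).const_mul (1 / 2 : ℝ)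
    have b3 := b2.congr_of_eventuallyEq (f₁ := fun x ↦ G x (christoffel G x u w) z)
      (hin.mono fun x hx ↦ by
        simp only [inner_christoffel hx, koszulForm_apply]; rfl)
    have := DFunLike.congr_fun (b1.unique b3) a
    simp at this
    linarith
  -- Pair the identity with `z`. The Koszul combination of `k1`, `k2`, `k3` isolates the second
  -- derivative of `ξ`; `k4` supplies the derivative of the Christoffel symbols along `ξ`; `k5`,
  -- `k6`, `k7` are the Koszul identity with the derivative of `ξ` inserted in each slot; `k8`
  -- trades the last term of the claim for terms that cancel against `k4` and `k7`. What follows the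
  -- `k`s only permutes arguments by symmetry.
  refine hin0.eq_of_forall fun z ↦ ?_
  have e (u w z : E) := inner_christoffel hin0 u w z
  simp only [koszulForm_apply] at e
  simp only [map_add, map_sub, map_zero, add_apply, sub_apply, zero_apply]
  have k1 := key u w z
  have k2 := key w u z
  have k3 := key z u w
  have k4 := dK (ξ y) u w z
  have k5 := e (fderiv ℝ ξ y u) w z
  have k6 := e u (fderiv ℝ ξ y w) z
  have k7 := e u w (fderiv ℝ ξ y z)
  have k8 := hK0 (christoffel G y u w) z
  rw [sG.eq (ξ y) u, sG.eq (ξ y) w, sG.eq (ξ y) z] at k4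
  rw [sξ.eq w u] at k2
  rw [sξ.eq z u, sξ.eq z w] at k3
  have f1 := hin0.symm w (fderiv ℝ (fderiv ℝ ξ) y u z)
  have f2 := hin0.symm u (fderiv ℝ (fderiv ℝ ξ) y w z)
  have fs := fderiv_symm dG hsym
  have g1 := fs u (fderiv ℝ ξ y w) z
  have g2 := fs w (fderiv ℝ ξ y u) z
  have g3 := fs z (fderiv ℝ ξ y u) w
  have g4 := fs (fderiv ℝ ξ y u) w z
  have g5 := fs (fderiv ℝ ξ y w) u z
  linarith

end Killing

/-! ### Connection metrics and their Christoffel symbols -/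

section Submersion

variable {E E' : Type*} [NormedAddCommGroup E] [NormedSpace ℝ E]
  [NormedAddCommGroup E'] [NormedSpace ℝ E']

/-- The vertical projection of a connection on the trivial bundle `E × E' → E` with connection
form `ξ`. -/
def vertProj (ξ : E × E' → E →L[ℝ] E') (y : E × E') : E × E' →L[ℝ] E' :=
  ContinuousLinearMap.snd ℝ E E' + ξ y ∘L ContinuousLinearMap.fst ℝ E E'

@[simp] theorem vertProj_apply (ξ : E × E' → E →L[ℝ] E') (y X : E × E') :
    vertProj ξ y X = X.2 + ξ y X.1 := rfl

/-- The horizontal lift of the connection with connection form `ξ`. -/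
def horLift (ξ : E × E' → E →L[ℝ] E') (y : E × E') : E →L[ℝ] E × E' :=
  (ContinuousLinearMap.id ℝ E).prod (-ξ y)

@[simp] theorem horLift_apply (ξ : E × E' → E →L[ℝ] E') (y : E × E') (v : E) :
    horLift ξ y v = (v, -ξ y v) := rfl

/-- The pull-back to the total space of a metric on the base. -/
def baseMetric (GB : E → E →L[ℝ] E →L[ℝ] ℝ) (y : E × E') : E × E' →L[ℝ] E × E' →L[ℝ] ℝ :=
  (GB y.1).bilinearComp (ContinuousLinearMap.fst ℝ E E') (ContinuousLinearMap.fst ℝ E E')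

@[simp] theorem baseMetric_apply (GB : E → E →L[ℝ] E →L[ℝ] ℝ) (y X Y : E × E') :
    baseMetric GB y X Y = GB y.1 X.1 Y.1 := rfl

/-- The vertical part of the connection metric. -/
def fibreMetric (GF : E' → E' →L[ℝ] E' →L[ℝ] ℝ) (ξ : E × E' → E →L[ℝ] E') (y : E × E') :
    E × E' →L[ℝ] E × E' →L[ℝ] ℝ :=
  (GF y.2).bilinearComp (vertProj ξ y) (vertProj ξ y)

@[simp] theorem fibreMetric_apply (GF : E' → E' →L[ℝ] E' →L[ℝ] ℝ) (ξ : E × E' → E →L[ℝ] E')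
    (y X Y : E × E') :
    fibreMetric GF ξ y X Y = GF y.2 (X.2 + ξ y X.1) (Y.2 + ξ y Y.1) := rfl

/-- The connection metric on the total space, with fibres scaled by `s`. -/
def connMetric (GB : E → E →L[ℝ] E →L[ℝ] ℝ) (GF : E' → E' →L[ℝ] E' →L[ℝ] ℝ)
    (ξ : E × E' → E →L[ℝ] E') (s : ℝ) (y : E × E') : E × E' →L[ℝ] E × E' →L[ℝ] ℝ :=
  baseMetric GB y + s • fibreMetric GF ξ y

theorem connMetric_apply (GB : E → E →L[ℝ] E →L[ℝ] ℝ) (GF : E' → E' →L[ℝ] E' →L[ℝ] ℝ)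
    (ξ : E × E' → E →L[ℝ] E') (s : ℝ) (y X Y : E × E') :
    connMetric GB GF ξ s y X Y =
      GB y.1 X.1 Y.1 + s * GF y.2 (X.2 + ξ y X.1) (Y.2 + ξ y Y.1) := rfl

/-- The value of the connection form on each base vector is a Killing field of `GF` along the
fibre through `y`. -/
def IsKillingForm (GF : E' → E' →L[ℝ] E' →L[ℝ] ℝ) (ξ : E × E' → E →L[ℝ] E') (y : E × E') : Prop :=
  ∀ (v : E) (w w' : E'), fderiv ℝ GF y.2 (ξ y v) w w' + GF y.2 (fderiv ℝ ξ y (0, w) v) w'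
    + GF y.2 w (fderiv ℝ ξ y (0, w') v) = 0

/-- The local data of a connection metric with Killing connection form. -/
structure IsConnectionData (GB : E → E →L[ℝ] E →L[ℝ] ℝ) (GF : E' → E' →L[ℝ] E' →L[ℝ] ℝ)
    (ξ : E × E' → E →L[ℝ] E') (y : E × E') : Prop where
  base : ContDiffAt ℝ 3 GB y.1
  fibre : ContDiffAt ℝ 3 GF y.2
  form : ContDiffAt ℝ 3 ξ y
  base_inner : ∀ᶠ b in 𝓝 y.1, IsInnerForm (GB b)
  fibre_inner : ∀ᶠ f in 𝓝 y.2, IsInnerForm (GF f)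
  killing : ∀ᶠ z in 𝓝 y, IsKillingForm GF ξ z

variable {GB : E → E →L[ℝ] E →L[ℝ] ℝ} {GF : E' → E' →L[ℝ] E' →L[ℝ] ℝ}
  {ξ : E × E' → E →L[ℝ] E'} {y : E × E'} {s : ℝ}

theorem IsConnectionData.eventually (h : IsConnectionData GB GF ξ y) :
    ∀ᶠ z in 𝓝 y, IsConnectionData GB GF ξ z := by
  have c1 : Tendsto (fun z : E × E' ↦ z.1) (𝓝 y) (𝓝 y.1) := continuous_fst.tendsto y
  have c2 : Tendsto (fun z : E × E' ↦ z.2) (𝓝 y) (𝓝 y.2) := continuous_snd.tendsto y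
  filter_upwards [c1.eventually (h.base.eventually (by simp)),
    c2.eventually (h.fibre.eventually (by simp)), h.form.eventually (by simp),
    c1.eventually h.base_inner.eventually_nhds, c2.eventually h.fibre_inner.eventually_nhds,
    h.killing.eventually_nhds] with z h1 h2 h3 h4 h5 h6
  exact ⟨h1, h2, h3, h4, h5, h6⟩

theorem isInnerForm_connMetric (hB : IsInnerForm (GB y.1)) (hF : IsInnerForm (GF y.2))
    (hs : 0 < s) : IsInnerForm (connMetric GB GF ξ s y) where
  symm X Y := by rw [connMetric_apply, connMetric_apply, hB.symm, hF.symm]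
  pos X hX := by
    rw [connMetric_apply]
    by_cases h1 : X.1 = 0
    · have h2 : X.2 ≠ 0 := fun h2 ↦ hX (Prod.ext h1 h2)
      rw [h1]
      simpa using mul_pos hs (hF.pos _ h2)
    · refine add_pos_of_pos_of_nonneg (hB.pos _ h1) (mul_nonneg hs.le ?_)
      by_cases h2 : X.2 + ξ y X.1 = 0
      · rw [h2]; simp
      · exact (hF.pos _ h2).le

/-- The horizontal vector dual to a functional, with respect to `GB`. -/
def horSharp (GB : E → E →L[ℝ] E →L[ℝ] ℝ) (ξ : E × E' → E →L[ℝ] E') (y : E × E') :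
    (E × E' →L[ℝ] ℝ) →L[ℝ] E × E' :=
  horLift ξ y ∘L (GB y.1).inverse ∘L (ContinuousLinearMap.compL ℝ E (E × E') ℝ).flip (horLift ξ y)

theorem horSharp_apply (ℓ : E × E' →L[ℝ] ℝ) :
    horSharp GB ξ y ℓ = horLift ξ y ((GB y.1).inverse (ℓ ∘L horLift ξ y)) := rfl

/-- The vertical vector dual to a functional, with respect to `GF`. -/
def verSharp (E : Type*) [NormedAddCommGroup E] [NormedSpace ℝ E]
    (GF : E' → E' →L[ℝ] E' →L[ℝ] ℝ) (f : E') : (E × E' →L[ℝ] ℝ) →L[ℝ] E × E' :=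
  ContinuousLinearMap.inr ℝ E E' ∘L (GF f).inverse ∘L
    (ContinuousLinearMap.compL ℝ E' (E × E') ℝ).flip (ContinuousLinearMap.inr ℝ E E')

theorem verSharp_apply (f : E') (ℓ : E × E' →L[ℝ] ℝ) :
    verSharp E GF f ℓ = (0, (GF f).inverse (ℓ ∘L ContinuousLinearMap.inr ℝ E E')) := rfl

/-- The limit of the Christoffel symbols of the connection metric as the fibres collapse. -/
def limitConn (GB : E → E →L[ℝ] E →L[ℝ] ℝ) (GF : E' → E' →L[ℝ] E' →L[ℝ] ℝ)
    (ξ : E × E' → E →L[ℝ] E') (y : E × E') : E × E' →L[ℝ] E × E' →L[ℝ] E × E' :=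
  (ContinuousLinearMap.compL ℝ (E × E') (E × E' →L[ℝ] ℝ) (E × E') (horSharp GB ξ y)) ∘L
      koszulForm (baseMetric GB) y
    + (ContinuousLinearMap.compL ℝ (E × E') (E × E' →L[ℝ] ℝ) (E × E') (verSharp E GF y.2)) ∘L
      koszulForm (fibreMetric GF ξ) y

theorem limitConn_apply (X Y : E × E') : limitConn GB GF ξ y X Y =
    horSharp GB ξ y (koszulForm (baseMetric GB) y X Y)
      + verSharp E GF y.2 (koszulForm (fibreMetric GF ξ) y X Y) := rfl

/-- The first order variation of the Christoffel symbols of the connection metric in the scale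
of the fibres. -/
def linearConn (GB : E → E →L[ℝ] E →L[ℝ] ℝ) (GF : E' → E' →L[ℝ] E' →L[ℝ] ℝ)
    (ξ : E × E' → E →L[ℝ] E') (y : E × E') : E × E' →L[ℝ] E × E' →L[ℝ] E × E' :=
  (ContinuousLinearMap.compL ℝ (E × E') (E × E' →L[ℝ] ℝ) (E × E') (horSharp GB ξ y)) ∘L
      koszulForm (fibreMetric GF ξ) y

theorem linearConn_apply (X Y : E × E') : linearConn GB GF ξ y X Y =
    horSharp GB ξ y (koszulForm (fibreMetric GF ξ) y X Y) := rfl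

variable [FiniteDimensional ℝ E] [FiniteDimensional ℝ E']

theorem contDiffAt_baseMetric {n : WithTop ℕ∞} (hB : ContDiffAt ℝ n GB y.1) :
    ContDiffAt ℝ n (baseMetric (E' := E') GB) y := by
  have h1 : ContDiffAt ℝ n (fun z : E × E' ↦ GB z.1) y := hB.comp y contDiffAt_fst
  refine contDiffAt_bilin_of_apply fun X Y ↦ ?_
  simp only [baseMetric_apply]
  exact (h1.clm_apply contDiffAt_const).clm_apply contDiffAt_const

theorem contDiffAt_fibreMetric {n : WithTop ℕ∞} (hF : ContDiffAt ℝ n GF y.2)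
    (hξ : ContDiffAt ℝ n ξ y) : ContDiffAt ℝ n (fibreMetric GF ξ) y := by
  have h1 : ContDiffAt ℝ n (fun z : E × E' ↦ GF z.2) y := hF.comp y contDiffAt_snd
  have h2 (X : E × E') : ContDiffAt ℝ n (fun z : E × E' ↦ X.2 + ξ z X.1) y :=
    contDiffAt_const.add (hξ.clm_apply contDiffAt_const)
  refine contDiffAt_bilin_of_apply fun X Y ↦ ?_
  simp only [fibreMetric_apply]
  exact (h1.clm_apply (h2 X)).clm_apply (h2 Y)

theorem contDiffAt_connMetric {n : WithTop ℕ∞} (hB : ContDiffAt ℝ n GB y.1)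
    (hF : ContDiffAt ℝ n GF y.2) (hξ : ContDiffAt ℝ n ξ y) :
    ContDiffAt ℝ n (connMetric GB GF ξ s) y :=
  (contDiffAt_baseMetric hB).add ((contDiffAt_fibreMetric hF hξ).const_smul s)

theorem contDiffAt_horSharp {n : WithTop ℕ∞} (hB : ContDiffAt ℝ n GB y.1)
    (hξ : ContDiffAt ℝ n ξ y) (hin : IsInnerForm (GB y.1)) :
    ContDiffAt ℝ n (horSharp GB ξ) y := by
  have h0 : ContDiffAt ℝ n (horLift ξ) y := contDiffAt_clm_of_apply fun v ↦ by
    simp only [horLift_apply]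
    exact contDiffAt_const.prodMk (hξ.clm_apply contDiffAt_const).neg
  have h1 : ContDiffAt ℝ n (fun z : E × E' ↦ GB z.1) y := hB.comp y contDiffAt_fst
  have h2 := contDiffAt_inverse_form h1 hin
  refine contDiffAt_clm_of_apply fun ℓ ↦ ?_
  simp only [horSharp_apply]
  exact h0.clm_apply (h2.clm_apply (contDiffAt_const.clm_comp h0))

theorem contDiffAt_verSharp {n : WithTop ℕ∞} (hF : ContDiffAt ℝ n GF y.2)
    (hin : IsInnerForm (GF y.2)) :
    ContDiffAt ℝ n (fun z : E × E' ↦ verSharp E GF z.2) y := by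
  have h1 : ContDiffAt ℝ n (fun z : E × E' ↦ GF z.2) y := hF.comp y contDiffAt_snd
  have h2 := contDiffAt_inverse_form h1 hin
  refine contDiffAt_clm_of_apply fun ℓ ↦ ?_
  simp only [verSharp_apply]
  exact contDiffAt_const.prodMk (h2.clm_apply contDiffAt_const)

theorem contDiffAt_limitConn (h : IsConnectionData GB GF ξ y) :
    ContDiffAt ℝ 2 (limitConn GB GF ξ) y := by
  have h1 := contDiffAt_horSharp h.base h.form h.base_inner.self_of_nhds
  have h2 := contDiffAt_verSharp (E := E) h.fibre h.fibre_inner.self_of_nhds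
  have h3 := contDiffAt_koszulForm (m := 2) (contDiffAt_baseMetric (E' := E') h.base) (by norm_num)
  have h4 := contDiffAt_koszulForm (m := 2) (contDiffAt_fibreMetric h.fibre h.form) (by norm_num)
  refine contDiffAt_bilin_of_apply fun X Y ↦ ?_
  simp only [limitConn_apply]
  exact ((h1.of_le (by norm_num)).clm_apply
    ((h3.clm_apply contDiffAt_const).clm_apply contDiffAt_const)).add
    ((h2.of_le (by norm_num)).clm_apply
    ((h4.clm_apply contDiffAt_const).clm_apply contDiffAt_const))

theorem contDiffAt_linearConn (h : IsConnectionData GB GF ξ y) :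
    ContDiffAt ℝ 2 (linearConn GB GF ξ) y := by
  have h1 := contDiffAt_horSharp h.base h.form h.base_inner.self_of_nhds
  have h4 := contDiffAt_koszulForm (m := 2) (contDiffAt_fibreMetric h.fibre h.form) (by norm_num)
  refine contDiffAt_bilin_of_apply fun X Y ↦ ?_
  simp only [linearConn_apply]
  exact ((h1.of_le (by norm_num)).clm_apply
    ((h4.clm_apply contDiffAt_const).clm_apply contDiffAt_const))

/-- In particular the form vanishes when `Z` is vertical, which is why no term in s⁻¹ survives in
`christoffel_connMetric`. -/
theorem koszulForm_baseMetric (hB1 : ContDiffAt ℝ 1 GB y.1) (X Y Z : E × E') :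
    koszulForm (baseMetric GB) y X Y Z = koszulForm GB y.1 X.1 Y.1 Z.1 := by
  have hd (U X Y : E × E') : fderiv ℝ (baseMetric GB) y U X Y = fderiv ℝ GB y.1 U.1 X.1 Y.1 := by
    have hB := hB1.differentiableAt (by norm_num)
    have hBd := (contDiffAt_baseMetric (E' := E') hB1).differentiableAt (by norm_num)
    have a1 := (hasFDerivAt_clm_apply_const hBd X).clm_apply (hasFDerivAt_const Y y)
    have a2 := ((hB.hasFDerivAt.comp y (hasFDerivAt_fst (p := y))).clm_apply
      (hasFDerivAt_const X.1 y)).clm_apply (hasFDerivAt_const Y.1 y)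
    have := DFunLike.congr_fun (a1.unique a2) U
    simpa using this
  rw [koszulForm_apply, koszulForm_apply, hd, hd, hd]

theorem koszulForm_add_smul {E : Type*} [NormedAddCommGroup E] [NormedSpace ℝ E]
    {G H : E → E →L[ℝ] E →L[ℝ] ℝ} {y : E} (hG : DifferentiableAt ℝ G y)
    (hH : DifferentiableAt ℝ H y) (c : ℝ) (v w z : E) :
    koszulForm (fun x ↦ G x + c • H x) y v w z =
      koszulForm G y v w z + c * koszulForm H y v w z := by
  have h : HasFDerivAt (fun x ↦ G x + c • H x) (fderiv ℝ G y + c • fderiv ℝ H y) y :=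
    hG.hasFDerivAt.add (hH.hasFDerivAt.const_smul c)
  rw [koszulForm_apply, koszulForm_apply, koszulForm_apply, h.fderiv]
  simp
  ring

/-- The vertical part of the inverse metric carries a factor s⁻¹, but on vertical vectors the Koszul
form reduces to `s` times that of the fibre metric. The factors cancel, and the dependence on `s` is
affine. The right-hand side makes sense at `s = 0`, where the metric degenerates. -/
theorem christoffel_connMetric (h : IsConnectionData GB GF ξ y) (hs : 0 < s) :
    christoffel (connMetric GB GF ξ s) y = limitConn GB GF ξ y + s • linearConn GB GF ξ y := by
  have hB := h.base_inner.self_of_nhds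
  have hF := h.fibre_inner.self_of_nhds
  refine ContinuousLinearMap.ext fun X ↦ ContinuousLinearMap.ext fun Y ↦ ?_
  rw [christoffel_eq_iff (isInnerForm_connMetric hB hF hs)]
  intro Z
  have e1 : koszulForm (connMetric GB GF ξ s) y X Y Z = koszulForm (baseMetric GB) y X Y Z
      + s * koszulForm (fibreMetric GF ξ) y X Y Z :=
    koszulForm_add_smul ((contDiffAt_baseMetric h.base).differentiableAt (by norm_num))
      ((contDiffAt_fibreMetric h.fibre h.form).differentiableAt (by norm_num)) s X Y Z
  -- Horizontal and vertical parts of the test vector; the base form sees only the former.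
  have hZ : Z = horLift ξ y Z.1 + ContinuousLinearMap.inr ℝ E E' (Z.2 + ξ y Z.1) := by
    ext <;> simp
  have kB : koszulForm (baseMetric GB) y X Y Z =
      koszulForm (baseMetric GB) y X Y (horLift ξ y Z.1) := by
    rw [koszulForm_baseMetric (h.base.of_le (by norm_num)),
      koszulForm_baseMetric (h.base.of_le (by norm_num))]
    rfl
  have kH : koszulForm (fibreMetric GF ξ) y X Y Z =
      koszulForm (fibreMetric GF ξ) y X Y (horLift ξ y Z.1) +
      koszulForm (fibreMetric GF ξ) y X Y (ContinuousLinearMap.inr ℝ E E' (Z.2 + ξ y Z.1)) := by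
    rw [← map_add, ← hZ]
  have i1 (ℓ : E →L[ℝ] ℝ) (v : E) : GB y.1 ((GB y.1).inverse ℓ) v = ℓ v := by
    rw [hB.isInvertible.self_apply_inverse]
  have i2 (ℓ : E' →L[ℝ] ℝ) (v : E') : GF y.2 ((GF y.2).inverse ℓ) v = ℓ v := by
    rw [hF.isInvertible.self_apply_inverse]
  set a := (GB y.1).inverse (koszulForm (baseMetric GB) y X Y ∘L horLift ξ y) with ha
  set b := (GB y.1).inverse (koszulForm (fibreMetric GF ξ) y X Y ∘L horLift ξ y) with hb
  set c := (GF y.2).inverse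
    (koszulForm (fibreMetric GF ξ) y X Y ∘L ContinuousLinearMap.inr ℝ E E') with hc
  -- The candidate has base component `a + s • b` and vertical projection `c`, so pairing with `Z`
  -- decouples into a base pairing and a fibre pairing.
  have hval : (limitConn GB GF ξ y + s • linearConn GB GF ξ y) X Y =
      (a + s • b, c - ξ y (a + s • b)) := by
    change horLift ξ y a + (0, c) + s • horLift ξ y b = _
    ext
    · simp
    · simp
      abel
  rw [e1, kB, kH, hval, connMetric_apply]
  simp only [sub_add_cancel]
  rw [map_add, add_apply, map_smul, smul_apply, ha, hb, hc, i1, i1, i2]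
  simp only [ContinuousLinearMap.comp_apply, smul_eq_mul]
  ring

end Submersion

/-! ### Ricci curvature in the collapsing limit -/

section Collapse

variable {E E' : Type*} [NormedAddCommGroup E] [NormedSpace ℝ E] [FiniteDimensional ℝ E]
  [NormedAddCommGroup E'] [NormedSpace ℝ E'] [FiniteDimensional ℝ E']
  {GB : E → E →L[ℝ] E →L[ℝ] ℝ} {GF : E' → E' →L[ℝ] E' →L[ℝ] ℝ}
  {ξ : E × E' → E →L[ℝ] E'} {y : E × E'} {s : ℝ}

theorem fderiv_fibreMetric (hF : ContDiffAt ℝ 1 GF y.2) (hξ : ContDiffAt ℝ 1 ξ y)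
    (U X Y : E × E') :
    fderiv ℝ (fibreMetric GF ξ) y U X Y = fderiv ℝ GF y.2 U.2 (vertProj ξ y X) (vertProj ξ y Y)
      + GF y.2 (fderiv ℝ ξ y U X.1) (vertProj ξ y Y)
      + GF y.2 (vertProj ξ y X) (fderiv ℝ ξ y U Y.1) := by
  have hd := (contDiffAt_fibreMetric hF hξ).differentiableAt (by norm_num)
  have dξ := hξ.differentiableAt (by norm_num)
  have dF := (hF.differentiableAt (by norm_num)).hasFDerivAt
  have hv (X : E × E') := (hasFDerivAt_const X.2 y).add (hasFDerivAt_clm_apply_const dξ X.1)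
  have a1 := (hasFDerivAt_clm_apply_const hd X).clm_apply (hasFDerivAt_const Y y)
  have a2 := ((dF.comp y (hasFDerivAt_snd (p := y))).clm_apply (hv X)).clm_apply (hv Y)
  have := DFunLike.congr_fun (a1.unique a2) U
  simp at this
  simp only [vertProj_apply, map_add, add_apply]
  rw [this]
  ring

/-- The vertical dual has no base component and the horizontal one lifts the dual with respect to
`GB`. The limit connection is thus projectable to the base. -/
theorem limitConn_fst (hB : ContDiffAt ℝ 1 GB y.1) (X Y : E × E') :
    (limitConn GB GF ξ y X Y).1 = christoffel GB y.1 X.1 Y.1 := by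
  rw [limitConn_apply, horSharp_apply, verSharp_apply, christoffel_apply]
  simp only [horLift_apply, Prod.fst_add, add_zero]
  congr 1
  ext z
  simp [koszulForm_baseMetric hB]

set_option linter.unusedSectionVars false in
theorem vertProj_limitConn (hF : IsInnerForm (GF y.2)) {X Y : E × E'} {x : E'}
    (h : ∀ z, GF y.2 x z = koszulForm (fibreMetric GF ξ) y X Y (0, z)) :
    vertProj ξ y (limitConn GB GF ξ y X Y) = x := by
  have h1 : vertProj ξ y (limitConn GB GF ξ y X Y) = (GF y.2).inverse
      (koszulForm (fibreMetric GF ξ) y X Y ∘L ContinuousLinearMap.inr ℝ E E') := by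
    rw [limitConn_apply, horSharp_apply, verSharp_apply]
    simp
  rw [h1]
  refine hF.eq_of_forall fun z ↦ ?_
  rw [hF.isInvertible.self_apply_inverse, h]
  rfl

/-- The Killing equation replaces the pairing of `u` with the derivative of `ξ` along the test
vector by a derivative of `GF` along `ξ y X.1`, which completes `X.2` to `vertProj ξ y X` in the
Koszul form of the fibre. For vertical `X` only the Christoffel symbols of the fibre remain: the
fibres are totally geodesic. -/
theorem limitConn_vert (h : IsConnectionData GB GF ξ y) (u : E') (X : E × E') :
    limitConn GB GF ξ y (0, u) X =
      (0, christoffel GF y.2 u (vertProj ξ y X) + fderiv ℝ ξ y (0, u) X.1) := by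
  have hF1 : ContDiffAt ℝ 1 GF y.2 := h.fibre.of_le (by norm_num)
  have hξ1 : ContDiffAt ℝ 1 ξ y := h.form.of_le (by norm_num)
  have hF := h.fibre_inner.self_of_nhds
  have hfst : (limitConn GB GF ξ y (0, u) X).1 = 0 := by
    rw [limitConn_fst (h.base.of_le (by norm_num))]; simp
  refine Prod.ext hfst ?_
  have hv := vertProj_limitConn (GB := GB) (ξ := ξ) hF (X := (0, u)) (Y := X)
    (x := christoffel GF y.2 u (vertProj ξ y X) + fderiv ℝ ξ y (0, u) X.1) ?_
  · rw [vertProj_apply, hfst, map_zero, add_zero] at hv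
    exact hv
  intro z
  have k := h.killing.self_of_nhds X.1 u z
  have fs := fderiv_symm (hF1.differentiableAt (by norm_num))
    (h.fibre_inner.mono fun z hz ↦ hz.symm)
  rw [map_add, add_apply, inner_christoffel hF, koszulForm_apply, koszulForm_apply]
  simp only [fderiv_fibreMetric hF1 hξ1]
  simp only [vertProj_apply, map_zero, add_zero, map_add, add_apply, zero_apply] at k ⊢
  linarith

/-- Same mechanism as `limitConn_vert`. With symmetry, these two formulas determine R(U, X)X for
vertical U: every Christoffel symbol in it has either a vertical argument or both arguments equal to
X. -/
theorem limitConn_diag (h : IsConnectionData GB GF ξ y) (X : E × E') :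
    limitConn GB GF ξ y X X =
      (christoffel GB y.1 X.1 X.1, christoffel GF y.2 (vertProj ξ y X) (vertProj ξ y X)
        + fderiv ℝ ξ y X X.1 + fderiv ℝ ξ y (0, vertProj ξ y X) X.1
        - ξ y (christoffel GB y.1 X.1 X.1)) := by
  have hF1 : ContDiffAt ℝ 1 GF y.2 := h.fibre.of_le (by norm_num)
  have hξ1 : ContDiffAt ℝ 1 ξ y := h.form.of_le (by norm_num)
  have hF := h.fibre_inner.self_of_nhds
  have hfst : (limitConn GB GF ξ y X X).1 = christoffel GB y.1 X.1 X.1 :=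
    limitConn_fst (h.base.of_le (by norm_num)) X X
  refine Prod.ext hfst ?_
  have hv := vertProj_limitConn (GB := GB) (ξ := ξ) hF (X := X) (Y := X)
    (x := christoffel GF y.2 (vertProj ξ y X) (vertProj ξ y X)
        + fderiv ℝ ξ y X X.1 + fderiv ℝ ξ y (0, vertProj ξ y X) X.1) ?_
  · rw [vertProj_apply, hfst] at hv
    exact eq_sub_of_add_eq hv
  intro z
  have k := h.killing.self_of_nhds X.1 (vertProj ξ y X) z
  have fs := fderiv_symm (hF1.differentiableAt (by norm_num))
    (h.fibre_inner.mono fun z hz ↦ hz.symm)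
  have f1 := hF.symm (vertProj ξ y X) (fderiv ℝ ξ y (0, z) X.1)
  rw [map_add, map_add, add_apply, add_apply, inner_christoffel hF, koszulForm_apply,
    koszulForm_apply]
  simp only [fderiv_fibreMetric hF1 hξ1]
  have e1 : vertProj ξ y (0, z) = z := by simp
  have e2 : fderiv ℝ GF y.2 (vertProj ξ y X) = fderiv ℝ GF y.2 X.2 + fderiv ℝ GF y.2 (ξ y X.1) := by
    rw [vertProj_apply, map_add]
  rw [e1, e2]
  simp only [map_zero, add_apply]
  linarith

theorem limitConn_symm (h : IsConnectionData GB GF ξ y) (X Y : E × E') :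
    limitConn GB GF ξ y X Y = limitConn GB GF ξ y Y X := by
  have c1 : Tendsto (fun z : E × E' ↦ z.1) (𝓝 y) (𝓝 y.1) := continuous_fst.tendsto y
  have c2 : Tendsto (fun z : E × E' ↦ z.2) (𝓝 y) (𝓝 y.2) := continuous_snd.tendsto y
  rw [limitConn_apply, limitConn_apply,
    koszulForm_symm ((contDiffAt_baseMetric h.base).differentiableAt (by norm_num))
      ((c1.eventually h.base_inner).mono fun z hz v w ↦ by simp [hz.symm]),
    koszulForm_symm ((contDiffAt_fibreMetric h.fibre h.form).differentiableAt (by norm_num))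
      ((c2.eventually h.fibre_inner).mono fun z hz v w ↦ by
        rw [fibreMetric_apply, fibreMetric_apply, hz.symm])]

/-- Curvature follows the projection of connections provided by `limitConn_fst`. -/
theorem connCurv_limitConn_fst (h : IsConnectionData GB GF ξ y) (X U : E × E') :
    (connCurv (limitConn GB GF ξ) y X X U).1 =
      connCurv (christoffel GB) y.1 X.1 X.1 U.1 := by
  have dΓ : DifferentiableAt ℝ (limitConn GB GF ξ) y :=
    (contDiffAt_limitConn h).differentiableAt (by norm_num)
  have hB := h.base_inner.self_of_nhds
  have dB : DifferentiableAt ℝ (christoffel GB) y.1 :=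
    (contDiffAt_christoffel (m := 2) h.base (by norm_num) hB).differentiableAt (by norm_num)
  have hd (U X Y : E × E') : (fderiv ℝ (limitConn GB GF ξ) y U X Y).1 =
      fderiv ℝ (christoffel GB) y.1 U.1 X.1 Y.1 := by
    have a1 := ((hasFDerivAt_clm_apply_const dΓ X).clm_apply (hasFDerivAt_const Y y)).fst
    have a2 := ((dB.hasFDerivAt.comp y (hasFDerivAt_fst (p := y))).clm_apply
      (hasFDerivAt_const X.1 y)).clm_apply (hasFDerivAt_const Y.1 y)
    have a3 := a2.congr_of_eventuallyEq (f₁ := fun z ↦ (limitConn GB GF ξ z X Y).1)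
      (h.eventually.mono fun z hz ↦ limitConn_fst (hz.base.of_le (by norm_num)) X Y)
    have := DFunLike.congr_fun (a1.unique a3) U
    simpa using this
  have hf := limitConn_fst (GF := GF) (ξ := ξ) (y := y) (h.base.of_le (by norm_num : (1 : WithTop ℕ∞) ≤ 3))
  rw [connCurv_apply, connCurv_apply]
  simp only [Prod.fst_add, Prod.fst_sub, hd, hf]

/-- Mixed second derivatives of `ξ` cancel by symmetry, and the remaining contributions of `ξ`
assemble into the affine Killing identity along the fibre, hence vanish. Only the curvature of the
fibre at the vertical part of `X` is left. -/
theorem connCurv_limitConn_vert (h : IsConnectionData GB GF ξ y) (X : E × E') (u : E') :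
    (connCurv (limitConn GB GF ξ) y X X (0, u)).2 =
      connCurv (christoffel GF) y.2 (vertProj ξ y X) (vertProj ξ y X) u := by
  have dΓ : DifferentiableAt ℝ (limitConn GB GF ξ) y :=
    (contDiffAt_limitConn h).differentiableAt (by norm_num)
  have hB := h.base_inner.self_of_nhds
  have hF := h.fibre_inner.self_of_nhds
  have dB : DifferentiableAt ℝ (christoffel GB) y.1 :=
    (contDiffAt_christoffel (m := 2) h.base (by norm_num) hB).differentiableAt (by norm_num)
  have dF : DifferentiableAt ℝ (christoffel GF) y.2 :=
    (contDiffAt_christoffel (m := 2) h.fibre (by norm_num) hF).differentiableAt (by norm_num)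
  have hξ1 : ContDiffAt ℝ 2 (fderiv ℝ ξ) y := h.form.fderiv_right (by norm_num)
  have dξ := h.form.differentiableAt (by norm_num)
  have dξ1 := hξ1.differentiableAt (by norm_num)
  have sξ := isSymmSndFDerivAt_of_contDiffAt (h.form.of_le (by norm_num : (2 : WithTop ℕ∞) ≤ 3))
  have hv := (hasFDerivAt_const X.2 y).add (hasFDerivAt_clm_apply_const dξ X.1)
  have dF' := dF.hasFDerivAt.comp y (hasFDerivAt_snd (p := y))
  have dB' := dB.hasFDerivAt.comp y (hasFDerivAt_fst (p := y))
  have c1 := hasFDerivAt_const (𝕜 := ℝ) X.1 y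
  -- the derivative of `limitConn X X` in the direction `u`
  have t1 : (fderiv ℝ (limitConn GB GF ξ) y (0, u) X X).2 =
      fderiv ℝ (christoffel GF) y.2 u (vertProj ξ y X) (vertProj ξ y X)
      + christoffel GF y.2 (fderiv ℝ ξ y (0, u) X.1) (vertProj ξ y X)
      + christoffel GF y.2 (vertProj ξ y X) (fderiv ℝ ξ y (0, u) X.1)
      + fderiv ℝ (fderiv ℝ ξ) y (0, u) X X.1
      + fderiv ℝ (fderiv ℝ ξ) y (0, u) (0, vertProj ξ y X) X.1
      + fderiv ℝ ξ y (0, fderiv ℝ ξ y (0, u) X.1) X.1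
      - fderiv ℝ ξ y (0, u) (christoffel GB y.1 X.1 X.1) := by
    have a1 := ((hasFDerivAt_clm_apply_const dΓ X).clm_apply (hasFDerivAt_const X y)).snd
    have b1 := (dF'.clm_apply hv).clm_apply hv
    have b2 := (hasFDerivAt_clm_apply_const dξ1 X).clm_apply c1
    have b3 := (dξ1.hasFDerivAt.clm_apply ((hasFDerivAt_const (0 : E) y).prodMk hv)).clm_apply c1
    have b4 := dξ.hasFDerivAt.clm_apply ((dB'.clm_apply c1).clm_apply c1)
    have a2 := ((b1.add b2).add b3).sub b4
    have a3 := a2.congr_of_eventuallyEq (f₁ := fun z ↦ (limitConn GB GF ξ z X X).2)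
      (h.eventually.mono fun z hz ↦ by
        simp only [limitConn_diag hz X]; rfl)
    have := DFunLike.congr_fun (a1.unique a3) ((0, u) : E × E')
    simp at this
    simp only [vertProj_apply]
    rw [this]
    simp only [map_add, add_apply]
    abel
  have t2 : (fderiv ℝ (limitConn GB GF ξ) y X (0, u) X).2 =
      fderiv ℝ (christoffel GF) y.2 X.2 u (vertProj ξ y X)
      + christoffel GF y.2 u (fderiv ℝ ξ y X X.1)
      + fderiv ℝ (fderiv ℝ ξ) y X (0, u) X.1 := by
    have a1 := ((hasFDerivAt_clm_apply_const dΓ (0, u)).clm_apply (hasFDerivAt_const X y)).snd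
    have b1 := (dF'.clm_apply (hasFDerivAt_const u y)).clm_apply hv
    have b2 := (hasFDerivAt_clm_apply_const dξ1 (0, u)).clm_apply c1
    have a3 := (b1.add b2).congr_of_eventuallyEq (f₁ := fun z ↦ (limitConn GB GF ξ z (0, u) X).2)
      (h.eventually.mono fun z hz ↦ by
        simp only [limitConn_vert hz u X]; rfl)
    have := DFunLike.congr_fun (a1.unique a3) X
    simp at this
    simp only [vertProj_apply]
    rw [this]
    simp only [map_add]
    abel
  have sF := christoffel_symm (h.fibre.differentiableAt (by norm_num))
    (h.fibre_inner.mono fun z hz ↦ hz.symm)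
  -- the affine Killing identity along the fibre
  have kill : fderiv ℝ (fderiv ℝ ξ) y (0, u) (0, vertProj ξ y X) X.1
      + fderiv ℝ (christoffel GF) y.2 (ξ y X.1) u (vertProj ξ y X)
      + christoffel GF y.2 (fderiv ℝ ξ y (0, u) X.1) (vertProj ξ y X)
      + christoffel GF y.2 u (fderiv ℝ ξ y (0, vertProj ξ y X) X.1)
      - fderiv ℝ ξ y (0, christoffel GF y.2 u (vertProj ξ y X)) X.1 = 0 := by
    -- The Killing field that the connection form assigns to `X.1` on the fibre over `y.1`; its
    -- derivatives are the vertical derivatives of `ξ`.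
    let η : E' → E' := fun f ↦ ξ (y.1, f) X.1
    have hi : ∀ f : E', HasFDerivAt (fun f' : E' ↦ (y.1, f')) (ContinuousLinearMap.inr ℝ E E') f :=
      fun f ↦ hasFDerivAt_prodMk_right y.1 f
    have ci : Tendsto (fun f' : E' ↦ (y.1, f')) (𝓝 y.2) (𝓝 y) :=
      (Continuous.prodMk_right y.1).tendsto y.2
    have hη : ContDiffAt ℝ 2 η y.2 :=
      ((h.form.of_le (by norm_num : (2 : WithTop ℕ∞) ≤ 3)).comp y.2
        (contDiffAt_const.prodMk contDiffAt_id)).clm_apply contDiffAt_const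
    have dη : ∀ᶠ f in 𝓝 y.2, fderiv ℝ η f =
        ((fderiv ℝ ξ (y.1, f)).flip X.1) ∘L ContinuousLinearMap.inr ℝ E E' := by
      filter_upwards [ci.eventually h.eventually] with f hf
      exact ((hasFDerivAt_clm_apply_const (hf.form.differentiableAt (by norm_num)) X.1).comp f
        (hi f)).fderiv
    have dη' (f w : E') (hf : fderiv ℝ η f =
        ((fderiv ℝ ξ (y.1, f)).flip X.1) ∘L ContinuousLinearMap.inr ℝ E E') :
        fderiv ℝ η f w = fderiv ℝ ξ (y.1, f) (0, w) X.1 := by rw [hf]; rfl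
    have ddη (a w : E') : fderiv ℝ (fderiv ℝ η) y.2 a w =
        fderiv ℝ (fderiv ℝ ξ) y (0, a) (0, w) X.1 := by
      have e1 : DifferentiableAt ℝ (fderiv ℝ η) y.2 :=
        (hη.fderiv_right (m := 1) (by norm_num)).differentiableAt (by norm_num)
      have e2 := hasFDerivAt_clm_apply_const e1 w
      have e3 := (((hasFDerivAt_clm_apply_const dξ1 (0, w)).clm_apply c1).comp y.2 (hi y.2))
      have e4 := e3.congr_of_eventuallyEq (f₁ := fun f ↦ fderiv ℝ η f w)
        (dη.mono fun f hf ↦ dη' f w hf)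
      have := DFunLike.congr_fun (e2.unique e4) a
      simpa using this
    have key := killing_christoffel (h.fibre.of_le (by norm_num)) hη h.fibre_inner (by
      filter_upwards [dη, ci.eventually h.killing] with f hf hk v w
      rw [dη' f v hf, dη' f w hf]
      exact hk X.1 v w) u (vertProj ξ y X)
    rw [ddη] at key
    simpa only [dη' y.2 _ dη.self_of_nhds] using key
  rw [connCurv_apply, connCurv_apply, Prod.snd_sub, Prod.snd_add, Prod.snd_sub, t1, t2,
    limitConn_diag h X, limitConn_vert h, limitConn_vert h, limitConn_symm h X, limitConn_vert h,
    sξ.eq X (0, u)]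
  -- The total derivative of the connection sees `X.2`, the fibre curvature sees `vertProj ξ y X`;
  -- the discrepancy is a derivative along `ξ y X.1`, which occurs in `kill`.
  have e1 : fderiv ℝ (christoffel GF) y.2 (vertProj ξ y X) =
      fderiv ℝ (christoffel GF) y.2 X.2 + fderiv ℝ (christoffel GF) y.2 (ξ y X.1) := by
    rw [vertProj_apply, map_add]
  have e2 : ((0 : E), christoffel GF y.2 u (vertProj ξ y X) + fderiv ℝ ξ y (0, u) X.1) =
      (0, christoffel GF y.2 u (vertProj ξ y X)) + (0, fderiv ℝ ξ y (0, u) X.1) := by simp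
  rw [e1, sF (vertProj ξ y X) (christoffel GF y.2 u (vertProj ξ y X)),
    sF (vertProj ξ y X) (fderiv ℝ ξ y (0, u) X.1)]
  have e3 : vertProj ξ y (christoffel GB y.1 X.1 X.1,
      christoffel GF y.2 (vertProj ξ y X) (vertProj ξ y X)
        + fderiv ℝ ξ y X X.1 + fderiv ℝ ξ y (0, vertProj ξ y X) X.1
        - ξ y (christoffel GB y.1 X.1 X.1)) =
      christoffel GF y.2 (vertProj ξ y X) (vertProj ξ y X)
        + fderiv ℝ ξ y X X.1 + fderiv ℝ ξ y (0, vertProj ξ y X) X.1 := by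
    rw [vertProj_apply]; simp
  rw [e3]
  dsimp only
  rw [e2]
  simp only [map_add, add_apply]
  rw [← sub_eq_zero, ← kill]
  abel

/-- The off-diagonal blocks are arbitrary, so the mixed curvature terms of the limit connection
never have to be computed. -/
theorem trace_eq_of_blocks (T : E × E' →ₗ[ℝ] E × E') (A : E →ₗ[ℝ] E) (C : E' →ₗ[ℝ] E')
    (hA : ∀ v, (T (v, 0)).1 = A v) (hC : ∀ w, (T (0, w)).2 = C w) :
    LinearMap.trace ℝ (E × E') T = LinearMap.trace ℝ E A + LinearMap.trace ℝ E' C := by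
  have h1 : T = (T ∘ₗ LinearMap.inl ℝ E E') ∘ₗ LinearMap.fst ℝ E E'
      + (T ∘ₗ LinearMap.inr ℝ E E') ∘ₗ LinearMap.snd ℝ E E' := by
    refine LinearMap.ext fun x ↦ ?_
    change T x = T (x.1, 0) + T (0, x.2)
    rw [← map_add]
    simp
  have h2 : LinearMap.fst ℝ E E' ∘ₗ T ∘ₗ LinearMap.inl ℝ E E' = A := by
    ext v; simp [hA]
  have h3 : LinearMap.snd ℝ E E' ∘ₗ T ∘ₗ LinearMap.inr ℝ E E' = C := by
    ext v; simp [hC]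
  rw [h1, map_add, LinearMap.trace_comp_comm', h2, LinearMap.trace_comp_comm', h3]

/-- The Ricci tensor of the limit connection is the sum of those of base and fibre. -/
theorem connRicci_limitConn (h : IsConnectionData GB GF ξ y) (X : E × E') :
    connRicci (limitConn GB GF ξ) y X X =
      coordRicci GB y.1 X.1 X.1 + coordRicci GF y.2 (vertProj ξ y X) (vertProj ξ y X) :=
  trace_eq_of_blocks _ _ _ (fun v ↦ connCurv_limitConn_fst h X (v, 0))
    (fun w ↦ connCurv_limitConn_vert h X w)

/-- Homogeneity reduces positivity to the compact unit sphere. -/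
theorem connRicci_smul {E : Type*} [NormedAddCommGroup E] [NormedSpace ℝ E]
    (Γ : E → E →L[ℝ] E →L[ℝ] E) (y v : E) (c : ℝ) :
    connRicci Γ y (c • v) (c • v) = c ^ 2 * connRicci Γ y v v := by
  have : (connCurv Γ y (c • v) (c • v)).toLinearMap = c ^ 2 • (connCurv Γ y v v).toLinearMap := by
    ext u
    simp only [ContinuousLinearMap.coe_coe, LinearMap.smul_apply, connCurv_apply, map_smul,
      smul_apply]
    module
  rw [connRicci, connRicci, this, map_smul, smul_eq_mul]

/-- The curvature is polynomial in `s`, `v` and the one-jets of the two summands. Applied at `s =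
0`, this is the passage to the limit in which the fibres collapse. -/
theorem continuousAt_connRicci_add_smul {E : Type*} [NormedAddCommGroup E] [NormedSpace ℝ E]
    [FiniteDimensional ℝ E] {Γ Γ' : E → E →L[ℝ] E →L[ℝ] E} {y : E} (h : ContDiffAt ℝ 1 Γ y)
    (h' : ContDiffAt ℝ 1 Γ' y) (s : ℝ) (v : E) :
    ContinuousAt (fun p : (ℝ × E) × E ↦ connRicci (fun z ↦ Γ z + p.1.1 • Γ' z) p.1.2 p.2 p.2)
      ((s, y), v) := by
  -- Continuity is phrased as smoothness of order 0 so that the pointwise criterion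
  -- `contDiffAt_clm_of_apply` applies to the curvature endomorphism.
  have hs : ContDiffAt ℝ 0 (fun p : (ℝ × E) × E ↦ p.1.1) ((s, y), v) := by fun_prop
  have hy : ContDiffAt ℝ 0 (fun p : (ℝ × E) × E ↦ p.1.2) ((s, y), v) := by fun_prop
  have hv : ContDiffAt ℝ 0 (fun p : (ℝ × E) × E ↦ p.2) ((s, y), v) := by fun_prop
  have comp {A : Type _} [NormedAddCommGroup A] [NormedSpace ℝ A] {f : E → A}
      (hf : ContDiffAt ℝ 0 f y) : ContDiffAt ℝ 0 (fun p : (ℝ × E) × E ↦ f p.1.2) ((s, y), v) :=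
    ContDiffAt.comp ((s, y), v) (g := f) (f := fun p : (ℝ × E) × E ↦ p.1.2) hf hy
  have a1 := comp (h.of_le zero_le_one)
  have a2 := comp (h'.of_le zero_le_one)
  have a3 := comp (h.fderiv_right (m := 0) (by norm_num))
  have a4 := comp (h'.fderiv_right (m := 0) (by norm_num))
  have hD := a3.add (hs.smul a4)
  have hΓ := a1.add (hs.smul a2)
  have key : ContDiffAt ℝ 0 (fun p : (ℝ × E) × E ↦
      connCurv (fun z ↦ Γ z + p.1.1 • Γ' z) p.1.2 p.2 p.2) ((s, y), v) := by
    refine contDiffAt_clm_of_apply fun u ↦ ?_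
    have cu : ContDiffAt ℝ 0 (fun _ : (ℝ × E) × E ↦ u) ((s, y), v) := contDiffAt_const
    refine ContDiffAt.congr_of_eventuallyEq ?_ (f := fun p : (ℝ × E) × E ↦
      (fderiv ℝ Γ p.1.2 + p.1.1 • fderiv ℝ Γ' p.1.2) u p.2 p.2
        - (fderiv ℝ Γ p.1.2 + p.1.1 • fderiv ℝ Γ' p.1.2) p.2 u p.2
        + (Γ p.1.2 + p.1.1 • Γ' p.1.2) u ((Γ p.1.2 + p.1.1 • Γ' p.1.2) p.2 p.2)
        - (Γ p.1.2 + p.1.1 • Γ' p.1.2) p.2 ((Γ p.1.2 + p.1.1 • Γ' p.1.2) u p.2)) ?_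
    · exact ((((hD.clm_apply cu).clm_apply hv).clm_apply hv).sub
        (((hD.clm_apply hv).clm_apply cu).clm_apply hv)).add
        ((hΓ.clm_apply cu).clm_apply ((hΓ.clm_apply hv).clm_apply hv)) |>.sub
        ((hΓ.clm_apply hv).clm_apply ((hΓ.clm_apply cu).clm_apply hv))
    · have ev : ∀ᶠ p : (ℝ × E) × E in 𝓝 ((s, y), v),
          ContDiffAt ℝ 1 Γ p.1.2 ∧ ContDiffAt ℝ 1 Γ' p.1.2 :=
        hy.continuousAt.eventually ((h.eventually (by simp)).and (h'.eventually (by simp)))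
      filter_upwards [ev] with p hp
      have hd : HasFDerivAt (fun z ↦ Γ z + p.1.1 • Γ' z)
          (fderiv ℝ Γ p.1.2 + p.1.1 • fderiv ℝ Γ' p.1.2) p.1.2 :=
        (hp.1.differentiableAt (by norm_num)).hasFDerivAt.add
          ((hp.2.differentiableAt (by norm_num)).hasFDerivAt.const_smul p.1.1)
      rw [connCurv_apply, hd.fderiv]
  have tr : Continuous (fun T : E →L[ℝ] E ↦ LinearMap.trace ℝ E T.toLinearMap) :=
    LinearMap.continuous_of_finiteDimensional
      ((LinearMap.trace ℝ E) ∘ₗ (ContinuousLinearMap.coeLM ℝ : (E →L[ℝ] E) →ₗ[ℝ] (E →ₗ[ℝ] E)))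
  exact tr.continuousAt.comp key.continuousAt

/-- If base and fibre have positive Ricci curvature, so has the connection metric with small
fibres. -/
theorem coordRicci_connMetric_pos (h : IsConnectionData GB GF ξ y)
    (hB : ∀ v, v ≠ 0 → 0 < coordRicci GB y.1 v v) (hF : ∀ v, v ≠ 0 → 0 < coordRicci GF y.2 v v) :
    ∃ ε > 0, ∀ᶠ z in 𝓝 y, ∀ s, 0 < s → s < ε → ∀ X ≠ 0,
      0 < coordRicci (connMetric GB GF ξ s) z X X := by
  let Q : ℝ × (E × E') → E × E' → ℝ := fun p X ↦
    connRicci (fun z ↦ limitConn GB GF ξ z + p.1 • linearConn GB GF ξ z) p.2 X X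
  have hpos : ∀ X ≠ 0, 0 < Q (0, y) X := by
    intro X hX
    have e : Q (0, y) X = connRicci (limitConn GB GF ξ) y X X := by
      simp only [Q, zero_smul, add_zero]
    rw [e, connRicci_limitConn h]
    by_cases h1 : X.1 = 0
    · have h2 : X.2 ≠ 0 := fun h2 ↦ hX (Prod.ext h1 h2)
      have e2 : vertProj ξ y X = X.2 := by rw [vertProj_apply, h1]; simp
      have e3 : coordRicci GB y.1 0 0 = 0 := by
        have := connRicci_smul (christoffel GB) y.1 0 0
        simpa [coordRicci_eq_connRicci] using this
      rw [h1, e2, e3, zero_add]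
      exact hF _ h2
    · refine add_pos_of_pos_of_nonneg (hB _ h1) ?_
      by_cases h2 : vertProj ξ y X = 0
      · have e3 : coordRicci GF y.2 0 0 = 0 := by
          have := connRicci_smul (christoffel GF) y.2 0 0
          simpa [coordRicci_eq_connRicci] using this
        rw [h2, e3]
      · exact (hF _ h2).le
  -- Compactness of the sphere makes the neighbourhood of `(0, y)` uniform in `X`. Shrinking it to a
  -- product yields an `ε` that does not depend on the point `z`.
  have hev : ∀ᶠ p in 𝓝 ((0 : ℝ), y), ∀ X ∈ Metric.sphere (0 : E × E') 1, 0 < Q p X := by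
    refine (isCompact_sphere (0 : E × E') 1).eventually_forall_of_forall_eventually fun X hX ↦ ?_
    have hc := continuousAt_connRicci_add_smul
      ((contDiffAt_limitConn h).of_le (by norm_num : (1 : WithTop ℕ∞) ≤ 2))
      ((contDiffAt_linearConn h).of_le (by norm_num)) 0 X
    exact hc.eventually (lt_mem_nhds (hpos X (Metric.ne_of_mem_sphere hX one_ne_zero)))
  rw [nhds_prod_eq, eventually_prod_iff] at hev
  obtain ⟨pa, ha, pb, hb, hab⟩ := hev
  obtain ⟨ε, hε, hεa⟩ := Metric.eventually_nhds_iff.1 ha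
  refine ⟨ε, hε, ?_⟩
  filter_upwards [hb, h.eventually.eventually_nhds] with z hz hdata s hs hsε X hX
  have hsa : pa s := hεa (by rwa [Real.dist_eq, sub_zero, abs_of_pos hs])
  have hn : ‖X‖ ≠ 0 := norm_ne_zero_iff.2 hX
  have h1 := hab hsa hz (‖X‖⁻¹ • X) (by simp [norm_smul, hn])
  have e : coordRicci (connMetric GB GF ξ s) z X X = Q (s, z) X := by
    -- Only for `s > 0` is `Q` the Ricci tensor of a metric. Equality near `z` is needed, as the
    -- curvature differentiates the connection.
    have : christoffel (connMetric GB GF ξ s) =ᶠ[𝓝 z]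
        fun z ↦ limitConn GB GF ξ z + s • linearConn GB GF ξ z :=
      hdata.mono fun x hx ↦ christoffel_connMetric hx hs
    rw [coordRicci_eq_connRicci]
    simp only [Q, connRicci, connCurv, this.fderiv_eq, this.self_of_nhds]
  have h2 : Q (s, z) (‖X‖⁻¹ • X) = ‖X‖⁻¹ ^ 2 * Q (s, z) X := connRicci_smul _ _ _ _
  rw [h2] at h1
  rw [e]
  exact pos_of_mul_pos_right h1 (sq_nonneg _)

end Collapse

/-! ### The manifold derivative as a map of model spaces -/

section ManifoldDerivative

variable {E E' E'' : Type*} [NormedAddCommGroup E] [NormedSpace ℝ E]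
  [NormedAddCommGroup E'] [NormedSpace ℝ E'] [NormedAddCommGroup E''] [NormedSpace ℝ E'']
  {M M' M'' : Type*} [TopologicalSpace M] [ChartedSpace E M] [TopologicalSpace M']
  [ChartedSpace E' M'] [TopologicalSpace M''] [ChartedSpace E'' M'']

/-- The manifold derivative, seen as a linear map between the model spaces. -/
def mder (f : M → M') (x : M) : E →L[ℝ] E' := mfderiv 𝓘(ℝ, E) 𝓘(ℝ, E') f x

theorem mder_comp {g : M' → M''} {f : M → M'} {x : M}
    (hg : MDifferentiableAt 𝓘(ℝ, E') 𝓘(ℝ, E'') g (f x))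
    (hf : MDifferentiableAt 𝓘(ℝ, E) 𝓘(ℝ, E') f x) :
    (mder (fun z ↦ g (f z)) x : E →L[ℝ] E'') = (mder g (f x) : E' →L[ℝ] E'') ∘L mder f x :=
  mfderiv_comp x hg hf

theorem mder_congr {f g : M → M'} {x : M} (h : f =ᶠ[𝓝 x] g) :
    (mder f x : E →L[ℝ] E') = mder g x := by
  unfold mder
  exact h.mfderiv_eq

theorem mder_eq_fderiv (f : E → E') (x : E) : mder f x = fderiv ℝ f x :=
  mfderiv_eq_fderiv

theorem mder_id (x : M) : (mder (fun z : M ↦ z) x : E →L[ℝ] E) = ContinuousLinearMap.id ℝ E :=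
  mfderiv_id

theorem mder_prodMk {f : M → E'} {g : M → E''} {x : M}
    (hf : MDifferentiableAt 𝓘(ℝ, E) 𝓘(ℝ, E') f x) (hg : MDifferentiableAt 𝓘(ℝ, E) 𝓘(ℝ, E'') g x) :
    (mder (fun z ↦ (f z, g z)) x : E →L[ℝ] E' × E'') = (mder f x : E →L[ℝ] E').prod (mder g x) := by
  have h : HasMFDerivAt 𝓘(ℝ, E) 𝓘(ℝ, E' × E'') (fun z ↦ (f z, g z)) x
      ((mder f x : E →L[ℝ] E').prod (mder g x : E →L[ℝ] E'')) :=
    ⟨hf.continuousAt.prodMk hg.continuousAt, hf.hasMFDerivAt.2.prodMk hg.hasMFDerivAt.2⟩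
  exact h.mfderiv

variable [IsManifold 𝓘(ℝ, E) ∞ M]

theorem contMDiffAt_extChartAt_of_mem {p x : M} (hx : x ∈ (extChartAt 𝓘(ℝ, E) p).source) :
    ContMDiffAt 𝓘(ℝ, E) 𝓘(ℝ, E) ∞ (extChartAt 𝓘(ℝ, E) p) x :=
  contMDiffAt_extChartAt' (by simpa using hx)

theorem contMDiffAt_extChartAt_symm_of_mem {p : M} {y : E}
    (hy : y ∈ (extChartAt 𝓘(ℝ, E) p).target) :
    ContMDiffAt 𝓘(ℝ, E) 𝓘(ℝ, E) ∞ (extChartAt 𝓘(ℝ, E) p).symm y :=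
  (contMDiffOn_extChartAt_symm p).contMDiffAt (extChartAt_target_mem_nhds' hy)

theorem mder_extChartAt_symm_comp {p x : M} (hx : x ∈ (extChartAt 𝓘(ℝ, E) p).source) :
    (mder (extChartAt 𝓘(ℝ, E) p).symm (extChartAt 𝓘(ℝ, E) p x) : E →L[ℝ] E) ∘L
      mder (extChartAt 𝓘(ℝ, E) p) x = ContinuousLinearMap.id ℝ E := by
  rw [← mder_comp, ← mder_id x]
  · refine mder_congr ?_
    filter_upwards [(isOpen_extChartAt_source p).mem_nhds hx] with z hz
    exact (extChartAt 𝓘(ℝ, E) p).left_inv hz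
  · exact (contMDiffAt_extChartAt_symm_of_mem
      ((extChartAt 𝓘(ℝ, E) p).map_source hx)).mdifferentiableAt (by simp)
  · exact (contMDiffAt_extChartAt_of_mem hx).mdifferentiableAt (by simp)

theorem mder_extChartAt_comp_symm {p x : M} (hx : x ∈ (extChartAt 𝓘(ℝ, E) p).source) :
    (mder (extChartAt 𝓘(ℝ, E) p) x : E →L[ℝ] E) ∘L
      mder (extChartAt 𝓘(ℝ, E) p).symm (extChartAt 𝓘(ℝ, E) p x) = ContinuousLinearMap.id ℝ E := by
  have hl := (extChartAt 𝓘(ℝ, E) p).left_inv hx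
  have hy := (extChartAt 𝓘(ℝ, E) p).map_source hx
  have h := mder_comp (g := extChartAt 𝓘(ℝ, E) p) (f := (extChartAt 𝓘(ℝ, E) p).symm)
    (x := extChartAt 𝓘(ℝ, E) p x)
    (by rw [hl]; exact (contMDiffAt_extChartAt_of_mem hx).mdifferentiableAt (by simp))
    ((contMDiffAt_extChartAt_symm_of_mem hy).mdifferentiableAt (by simp))
  rw [hl] at h
  rw [← h, ← mder_id (extChartAt 𝓘(ℝ, E) p x)]
  refine mder_congr ?_
  filter_upwards [extChartAt_target_mem_nhds' hy] with z hz
  exact (extChartAt 𝓘(ℝ, E) p).right_inv hz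

end ManifoldDerivative

/-! ### Riemannian metrics read in charts -/

section MetricInCharts

variable {E E' : Type*} [NormedAddCommGroup E] [NormedSpace ℝ E]
  [NormedAddCommGroup E'] [NormedSpace ℝ E']
  {M : Type*} [TopologicalSpace M] [ChartedSpace E M] [IsManifold 𝓘(ℝ, E) ∞ M]

/-- A Riemannian metric, seen as a family of bilinear forms on the model space. -/
def metricForm (g : RiemMetric E M) (x : M) : E →L[ℝ] E →L[ℝ] ℝ := g.inner x

theorem isInnerForm_metricForm (g : RiemMetric E M) (x : M) : IsInnerForm (metricForm g x) where
  symm := g.symm x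
  pos := g.pos x

theorem chartMetric_eq (g : RiemMetric E M) (p : M) (y v w : E) :
    chartMetric g p y v w = metricForm g ((extChartAt 𝓘(ℝ, E) p).symm y)
      (mder (extChartAt 𝓘(ℝ, E) p).symm y v) (mder (extChartAt 𝓘(ℝ, E) p).symm y w) := rfl

theorem ricci_eq (g : RiemMetric E M) (p : M) (v w : E) :
    ricci g p v w = coordRicci (chartMetric g p) (extChartAt 𝓘(ℝ, E) p p)
      (mder (extChartAt 𝓘(ℝ, E) p) p v) (mder (extChartAt 𝓘(ℝ, E) p) p w) := rfl

theorem metricForm_eq_chartMetric (g : RiemMetric E M) {p x : M}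
    (hx : x ∈ (extChartAt 𝓘(ℝ, E) p).source) (v w : E) :
    metricForm g x v w = chartMetric g p (extChartAt 𝓘(ℝ, E) p x)
      (mder (extChartAt 𝓘(ℝ, E) p) x v) (mder (extChartAt 𝓘(ℝ, E) p) x w) := by
  have h := DFunLike.congr_fun (mder_extChartAt_symm_comp hx)
  simp only [ContinuousLinearMap.comp_apply, ContinuousLinearMap.id_apply] at h
  rw [chartMetric_eq, h, h, (extChartAt 𝓘(ℝ, E) p).left_inv hx]

theorem isInnerForm_chartMetric (g : RiemMetric E M) {p : M} {y : E}
    (hy : y ∈ (extChartAt 𝓘(ℝ, E) p).target) : IsInnerForm (chartMetric g p y) where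
  symm v w := by rw [chartMetric_eq, chartMetric_eq, (isInnerForm_metricForm g _).symm]
  pos v hv := by
    rw [chartMetric_eq]
    refine (isInnerForm_metricForm g _).pos _ fun h0 ↦ hv ?_
    have h := DFunLike.congr_fun
      (mder_extChartAt_comp_symm ((extChartAt 𝓘(ℝ, E) p).map_target hy)) v
    rw [(extChartAt 𝓘(ℝ, E) p).right_inv hy] at h
    rw [ContinuousLinearMap.comp_apply, h0, map_zero] at h
    exact h.symm


end MetricInCharts

/-! ### Constructing metrics and computing Ricci curvature from local forms -/

section SmoothMetric

variable {E E' : Type*} [NormedAddCommGroup E] [NormedSpace ℝ E]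
  [NormedAddCommGroup E'] [NormedSpace ℝ E']
  {M : Type*} [TopologicalSpace M] [ChartedSpace E M] [IsManifold 𝓘(ℝ, E) ∞ M]

theorem inCoordinates_bilin_apply {p x : M} (hx : x ∈ (chartAt E p).source)
    (b : TangentSpace 𝓘(ℝ, E) x →L[ℝ] TangentSpace 𝓘(ℝ, E) x →L[ℝ] ℝ) (v w : E) :
    ContinuousLinearMap.inCoordinates E (TangentSpace 𝓘(ℝ, E)) (E →L[ℝ] ℝ)
      (fun x : M ↦ TangentSpace 𝓘(ℝ, E) x →L[ℝ] ℝ) p x p x b v w =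
    b ((trivializationAt E (TangentSpace 𝓘(ℝ, E)) p).symmL ℝ x v)
      ((trivializationAt E (TangentSpace 𝓘(ℝ, E)) p).symmL ℝ x w) := by
  rw [ContinuousLinearMap.inCoordinates, ContinuousLinearMap.comp_apply,
    ContinuousLinearMap.comp_apply, Bundle.Trivialization.continuousLinearMapAt_apply,
    Bundle.Trivialization.linearMapAt_apply, if_pos (by simp [hx]), hom_trivializationAt_apply]
  simp [ContinuousLinearMap.inCoordinates]

theorem symmL_trivializationAt_eq_mder {p x : M} (hx : x ∈ (chartAt E p).source) (v : E) :
    (trivializationAt E (TangentSpace 𝓘(ℝ, E)) p).symmL ℝ x v =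
      (mder (extChartAt 𝓘(ℝ, E) p).symm (extChartAt 𝓘(ℝ, E) p x) : E →L[ℝ] E) v := by
  rw [TangentBundle.symmL_trivializationAt hx]
  have : Set.range (𝓘(ℝ, E)) = Set.univ := by simp
  rw [this, mfderivWithin_univ]
  rfl

/-- Smoothness of a field of bilinear forms, in terms of the coordinate fields. -/
theorem contMDiffAt_bilin_section_iff [FiniteDimensional ℝ E]
    (b : ∀ x : M, TangentSpace 𝓘(ℝ, E) x →L[ℝ] TangentSpace 𝓘(ℝ, E) x →L[ℝ] ℝ)
    (b' : M → E →L[ℝ] E →L[ℝ] ℝ) (hb : ∀ x, b x = b' x) (p : M) :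
    ContMDiffAt 𝓘(ℝ, E) (𝓘(ℝ, E).prod 𝓘(ℝ, E →L[ℝ] E →L[ℝ] ℝ)) ∞
      (fun x ↦ Bundle.TotalSpace.mk' (E →L[ℝ] E →L[ℝ] ℝ) x (b x)) p ↔
    ContMDiffAt 𝓘(ℝ, E) 𝓘(ℝ, E →L[ℝ] E →L[ℝ] ℝ) ∞ (fun x : M ↦ (b' x).bilinearComp
        (mder (extChartAt 𝓘(ℝ, E) p).symm (extChartAt 𝓘(ℝ, E) p x) : E →L[ℝ] E)
        (mder (extChartAt 𝓘(ℝ, E) p).symm (extChartAt 𝓘(ℝ, E) p x) : E →L[ℝ] E)) p := by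
  have hev : (fun x ↦ ContinuousLinearMap.inCoordinates E (TangentSpace 𝓘(ℝ, E)) (E →L[ℝ] ℝ)
      (fun x : M ↦ TangentSpace 𝓘(ℝ, E) x →L[ℝ] ℝ) p x p x (b x)) =ᶠ[𝓝 p]
      (fun x : M ↦ (b' x).bilinearComp
        (mder (extChartAt 𝓘(ℝ, E) p).symm (extChartAt 𝓘(ℝ, E) p x) : E →L[ℝ] E)
        (mder (extChartAt 𝓘(ℝ, E) p).symm (extChartAt 𝓘(ℝ, E) p x) : E →L[ℝ] E)) := by
    filter_upwards [chart_source_mem_nhds E p] with x hx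
    ext v w
    rw [inCoordinates_bilin_apply hx, symmL_trivializationAt_eq_mder hx,
      symmL_trivializationAt_eq_mder hx, hb]
    rfl
  rw [contMDiffAt_hom_bundle]
  constructor
  · rintro ⟨-, h⟩
    exact h.congr_of_eventuallyEq hev.symm
  · intro h
    exact ⟨contMDiffAt_id, h.congr_of_eventuallyEq hev⟩

theorem contDiffAt_chartMetric [FiniteDimensional ℝ E] (g : RiemMetric E M) (p : M) :
    ContDiffAt ℝ ∞ (chartMetric g p) (extChartAt 𝓘(ℝ, E) p p) := by
  have h1 := (contMDiffAt_bilin_section_iff g.inner (metricForm g) (fun _ ↦ rfl) p).1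
    (g.contMDiff p)
  have ht := mem_extChartAt_target (I := 𝓘(ℝ, E)) p
  have h2 := contMDiffAt_extChartAt_symm_of_mem ht
  have hp : (extChartAt 𝓘(ℝ, E) p).symm (extChartAt 𝓘(ℝ, E) p p) = p := extChartAt_to_inv p
  have h3 := ContMDiffAt.comp_of_eq h1 h2 hp
  rw [contMDiffAt_iff_contDiffAt] at h3
  refine h3.congr_of_eventuallyEq ?_
  filter_upwards [extChartAt_target_mem_nhds' ht] with y hy
  ext v w
  simp only [Function.comp_apply, (extChartAt 𝓘(ℝ, E) p).right_inv hy]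
  rfl

/-- If c > 0 is the minimum of the form on the unit sphere, then b(v, v) ≥ c‖v‖², so the unit ball
of the form lies in the ball of radius √(1/c). -/
theorem isVonNBounded_of_isInnerForm [FiniteDimensional ℝ E] {b : E →L[ℝ] E →L[ℝ] ℝ}
    (hb : IsInnerForm b) : Bornology.IsVonNBounded ℝ {v : E | b v v < 1} := by
  rw [NormedSpace.isVonNBounded_iff]
  -- The sphere is empty when `E` is trivial, and then there is no minimum to take.
  rcases (Metric.sphere (0 : E) 1).eq_empty_or_nonempty with hS | hS
  · refine (Bornology.isBounded_singleton (x := (0 : E))).subset fun v _ ↦ ?_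
    rw [Set.mem_singleton_iff]
    by_contra hv
    have : ‖v‖⁻¹ • v ∈ Metric.sphere (0 : E) 1 := by
      simp [norm_smul, norm_ne_zero_iff.2 hv]
    rw [hS] at this
    exact this
  · obtain ⟨v₀, hv₀, hmin⟩ := (isCompact_sphere (0 : E) 1).exists_isMinOn hS
      (f := fun v ↦ b v v) (by fun_prop)
    have hc := hb.pos v₀ (Metric.ne_of_mem_sphere hv₀ one_ne_zero)
    refine (Metric.isBounded_closedBall (x := (0 : E)) (r := √(b v₀ v₀)⁻¹)).subset fun v hv ↦ ?_
    rw [mem_closedBall_zero_iff]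
    by_cases h0 : v = 0
    · simp [h0]
    have hn : 0 < ‖v‖ := norm_pos_iff.2 h0
    have h1 : b v₀ v₀ ≤ b (‖v‖⁻¹ • v) (‖v‖⁻¹ • v) :=
      hmin (by simp [norm_smul, hn.ne'] : ‖v‖⁻¹ • v ∈ Metric.sphere (0 : E) 1)
    simp only [map_smul, smul_apply, smul_eq_mul] at h1
    refine Real.le_sqrt_of_sq_le ?_
    have hv' : b v v < 1 := hv
    have h2 : b v₀ v₀ * ‖v‖ ^ 2 ≤ b v v := by
      calc b v₀ v₀ * ‖v‖ ^ 2 ≤ (‖v‖⁻¹ * (‖v‖⁻¹ * b v v)) * ‖v‖ ^ 2 := by gcongr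
        _ = b v v := by field_simp
    rw [← one_div, le_div_iff₀ hc]
    linarith [mul_comm (b v₀ v₀) (‖v‖ ^ 2)]

/-- `b` is the pull-back of `G'` under `Φ`, near `p`. -/
def IsLocalForm (b : M → E →L[ℝ] E →L[ℝ] ℝ) (Φ : M → E') (G' : E' → E' →L[ℝ] E' →L[ℝ] ℝ)
    (p : M) : Prop :=
  ∀ᶠ m in 𝓝 p, ∀ v w, b m v w =
    G' (Φ m) ((mder Φ m : E →L[ℝ] E') v) ((mder Φ m : E →L[ℝ] E') w)

/-- Smoothness of order `∞` at a point gives a neighbourhood for each finite order, possibly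
shrinking with the order. Order 3 is what the transformation of curvature uses. -/
theorem eventually_contMDiffAt {M' : Type*} [TopologicalSpace M'] [ChartedSpace E' M']
    [IsManifold 𝓘(ℝ, E') ∞ M'] {Φ : M → M'} {p : M}
    (hΦ : ContMDiffAt 𝓘(ℝ, E) 𝓘(ℝ, E') ∞ Φ p) :
    ∀ᶠ m in 𝓝 p, ContMDiffAt 𝓘(ℝ, E) 𝓘(ℝ, E') 3 Φ m :=
  have : IsManifold 𝓘(ℝ, E) 3 M := IsManifold.of_le (n := ∞) ENat.LEInfty.out
  have : IsManifold 𝓘(ℝ, E') 3 M' := IsManifold.of_le (n := ∞) ENat.LEInfty.out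
  (contMDiffAt_iff_contMDiffAt_nhds (by simp)).1 (hΦ.of_le ENat.LEInfty.out)

/-- The Riemannian metric defined by a field of inner products which is locally the pull-back of
a smooth field of forms on a vector space. -/
def mkMetric [FiniteDimensional ℝ E] (b : M → E →L[ℝ] E →L[ℝ] ℝ) (hin : ∀ m, IsInnerForm (b m))
    (hsm : ∀ p : M, ∃ (Φ : M → E') (G' : E' → E' →L[ℝ] E' →L[ℝ] ℝ),
      ContMDiffAt 𝓘(ℝ, E) 𝓘(ℝ, E') ∞ Φ p ∧ ContDiffAt ℝ ∞ G' (Φ p) ∧ IsLocalForm b Φ G' p) :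
    RiemMetric E M where
  inner x := b x
  symm x := (hin x).symm
  pos x := (hin x).pos
  isVonNBounded x := by
    have h := isVonNBounded_of_isInnerForm (hin x)
    exact h
  contMDiff p := by
    refine (contMDiffAt_bilin_section_iff _ b (fun _ ↦ rfl) p).2 ?_
    obtain ⟨Φ, G', hΦ, hG', hloc⟩ := hsm p
    have hps := mem_extChartAt_source (I := 𝓘(ℝ, E)) p
    have ht := mem_extChartAt_target (I := 𝓘(ℝ, E)) p
    have hp : (extChartAt 𝓘(ℝ, E) p).symm (extChartAt 𝓘(ℝ, E) p p) = p := extChartAt_to_inv p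
    -- In the chart at `p` the form becomes the pull-back of `G'` under `φ`, whose smoothness is a
    -- matter of calculus in vector spaces.
    let φ : E → E' := fun y ↦ Φ ((extChartAt 𝓘(ℝ, E) p).symm y)
    have hφ : ContDiffAt ℝ ∞ φ (extChartAt 𝓘(ℝ, E) p p) :=
      contMDiffAt_iff_contDiffAt.1
        (ContMDiffAt.comp_of_eq hΦ (contMDiffAt_extChartAt_symm_of_mem ht) hp)
    have hφ1 : ContDiffAt ℝ ∞ (fderiv ℝ φ) (extChartAt 𝓘(ℝ, E) p p) := hφ.fderiv_right (by simp)
    have hGφ : ContDiffAt ℝ ∞ (fun y ↦ G' (φ y)) (extChartAt 𝓘(ℝ, E) p p) := by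
      refine ContDiffAt.comp (extChartAt 𝓘(ℝ, E) p p) (g := G') (f := φ) ?_ hφ
      simpa only [φ, hp] using hG'
    have hk : ContDiffAt ℝ ∞ (fun y ↦ (G' (φ y)).bilinearComp (fderiv ℝ φ y) (fderiv ℝ φ y))
        (extChartAt 𝓘(ℝ, E) p p) :=
      contDiffAt_bilin_of_apply fun v w ↦ by
        simp only [ContinuousLinearMap.bilinearComp_apply]
        exact (hGφ.clm_apply (hφ1.clm_apply contDiffAt_const)).clm_apply
          (hφ1.clm_apply contDiffAt_const)
    refine (ContMDiffAt.comp p hk.contMDiffAt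
      (contMDiffAt_extChartAt_of_mem hps)).congr_of_eventuallyEq ?_
    filter_upwards [hloc, eventually_contMDiffAt hΦ,
      (isOpen_extChartAt_source p).mem_nhds hps] with x hx hdx hxs
    have hl := (extChartAt 𝓘(ℝ, E) p).left_inv hxs
    have hd : fderiv ℝ φ (extChartAt 𝓘(ℝ, E) p x) = (mder Φ x : E →L[ℝ] E') ∘L
        mder (extChartAt 𝓘(ℝ, E) p).symm (extChartAt 𝓘(ℝ, E) p x) := by
      rw [← mder_eq_fderiv]
      have := mder_comp (g := Φ) (f := (extChartAt 𝓘(ℝ, E) p).symm) (x := extChartAt 𝓘(ℝ, E) p x)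
        (by rw [hl]; exact hdx.mdifferentiableAt (by simp)) ((contMDiffAt_extChartAt_symm_of_mem
          ((extChartAt 𝓘(ℝ, E) p).map_source hxs)).mdifferentiableAt (by simp))
      rwa [hl] at this
    ext v w
    simp only [Function.comp_apply, ContinuousLinearMap.bilinearComp_apply, hd, hx, φ, hl,
      ContinuousLinearMap.comp_apply]

/-- The Ricci tensor can be computed in any local chart. -/
theorem ricci_eq_of_isLocalForm [FiniteDimensional ℝ E] [FiniteDimensional ℝ E']
    (g : RiemMetric E M) {Φ : M → E'} {p : M} {G' : E' → E' →L[ℝ] E' →L[ℝ] ℝ}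
    (hΦ : ContMDiffAt 𝓘(ℝ, E) 𝓘(ℝ, E') 3 Φ p) (hi : (mder Φ p : E →L[ℝ] E').IsInvertible)
    (hloc : IsLocalForm (metricForm g) Φ G' p) (hG' : ContDiffAt ℝ 2 G' (Φ p))
    (hin : ∀ᶠ z in 𝓝 (Φ p), IsInnerForm (G' z)) (v w : E) :
    ricci g p v w = coordRicci G' (Φ p) ((mder Φ p : E →L[ℝ] E') v)
      ((mder Φ p : E →L[ℝ] E') w) := by
  have hps := mem_extChartAt_source (I := 𝓘(ℝ, E)) p
  have ht := mem_extChartAt_target (I := 𝓘(ℝ, E)) p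
  have hp : (extChartAt 𝓘(ℝ, E) p).symm (extChartAt 𝓘(ℝ, E) p p) = p := extChartAt_to_inv p
  let φ : E → E' := fun y ↦ Φ ((extChartAt 𝓘(ℝ, E) p).symm y)
  have hφ : ContDiffAt ℝ 3 φ (extChartAt 𝓘(ℝ, E) p p) :=
    contMDiffAt_iff_contDiffAt.1 (ContMDiffAt.comp_of_eq hΦ
      ((contMDiffAt_extChartAt_symm_of_mem ht).of_le ENat.LEInfty.out) hp)
  have hφp : φ (extChartAt 𝓘(ℝ, E) p p) = Φ p := by simp only [φ, hp]
  have : IsManifold 𝓘(ℝ, E) 3 M := IsManifold.of_le (n := ∞) ENat.LEInfty.out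
  have hΦe := (contMDiffAt_iff_contMDiffAt_nhds (by simp)).1 hΦ
  have hdev : ∀ᶠ y in 𝓝 (extChartAt 𝓘(ℝ, E) p p), fderiv ℝ φ y =
      (mder Φ ((extChartAt 𝓘(ℝ, E) p).symm y) : E →L[ℝ] E') ∘L
        mder (extChartAt 𝓘(ℝ, E) p).symm y := by
    have hc := (contMDiffAt_extChartAt_symm_of_mem ht).continuousAt
    rw [ContinuousAt, hp] at hc
    filter_upwards [hc.eventually hΦe, extChartAt_target_mem_nhds' ht]
      with y hy hyt
    rw [← mder_eq_fderiv]
    exact mder_comp (hy.mdifferentiableAt (by simp))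
      ((contMDiffAt_extChartAt_symm_of_mem hyt).mdifferentiableAt (by simp))
  have hpull : IsPullbackAt φ (chartMetric g p) G' (extChartAt 𝓘(ℝ, E) p p) := by
    have hc := (contMDiffAt_extChartAt_symm_of_mem ht).continuousAt
    rw [ContinuousAt, hp] at hc
    filter_upwards [hc.eventually hloc, hdev] with y hy hd v w
    rw [chartMetric_eq, hy, hd]
    rfl
  have hd := hdev.self_of_nhds
  rw [hp] at hd
  have hid := mder_extChartAt_symm_comp hps
  have happly (v : E) : fderiv ℝ φ (extChartAt 𝓘(ℝ, E) p p)
      ((mder (extChartAt 𝓘(ℝ, E) p) p : E →L[ℝ] E) v) = (mder Φ p : E →L[ℝ] E') v := by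
    rw [hd]
    exact congrArg (mder Φ p : E →L[ℝ] E') (DFunLike.congr_fun hid v)
  have hinv : (fderiv ℝ φ (extChartAt 𝓘(ℝ, E) p p)).IsInvertible := by
    rw [hd]
    exact hi.comp (.of_inverse hid (mder_extChartAt_comp_symm hps))
  rw [ricci_eq, hpull.coordRicci_eq hφ hinv (by rwa [hφp]) (by rwa [hφp]), hφp, happly, happly]

/-- Every coordinate vector is the image of a tangent vector under the chart. Only the centre of the
chart is covered, since `ricci` at `p` uses the chart at `p`; this is enough for
`coordRicci_connMetric_pos`. -/
theorem coordRicci_chartMetric_pos (g : RiemMetric E M) (hg : HasPositiveRicci g) (p : M) (v : E)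
    (hv : v ≠ 0) : 0 < coordRicci (chartMetric g p) (extChartAt 𝓘(ℝ, E) p p) v v := by
  have hps := mem_extChartAt_source (I := 𝓘(ℝ, E)) p
  let A : E →L[ℝ] E := mder (extChartAt 𝓘(ℝ, E) p).symm (extChartAt 𝓘(ℝ, E) p p)
  have h1 : (mder (extChartAt 𝓘(ℝ, E) p) p : E →L[ℝ] E) (A v) = v :=
    DFunLike.congr_fun (mder_extChartAt_comp_symm hps) v
  have h2 : A v ≠ 0 := fun h0 ↦ hv (by rw [← h1, h0, map_zero])
  have h3 : 0 < ricci g p (A v) (A v) := hg p (A v) h2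
  rwa [ricci_eq, h1] at h3

end SmoothMetric

/-! ### Killing connection forms from families of isometries -/

section Gauge

variable {E E' : Type*} [NormedAddCommGroup E] [NormedSpace ℝ E]
  [NormedAddCommGroup E'] [NormedSpace ℝ E']

/-- `ψ` is, near `y`, a family of isometries of `GF` parametrized by `E` which reduces to the
identity at the parameter `y.1`. -/
structure IsIsometryFamily (GF : E' → E' →L[ℝ] E' →L[ℝ] ℝ) (ψ : E × E' → E') (y : E × E') :
    Prop where
  contDiffAt : ContDiffAt ℝ 2 ψ y
  eq_id : ∀ᶠ f in 𝓝 y.2, ψ (y.1, f) = f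
  isometry : ∀ᶠ z in 𝓝 y, ∀ w w', GF (ψ z) (fderiv ℝ ψ z (0, w)) (fderiv ℝ ψ z (0, w')) =
    GF z.2 w w'

variable {GF : E' → E' →L[ℝ] E' →L[ℝ] ℝ} {y : E × E'}

theorem IsIsometryFamily.fderiv_vert {ψ : E × E' → E'} (h : IsIsometryFamily GF ψ y) (w : E') :
    fderiv ℝ ψ y (0, w) = w := by
  have hd := (h.contDiffAt.differentiableAt (by norm_num)).hasFDerivAt
  have h1 : HasFDerivAt (fun f ↦ ψ (y.1, f)) (fderiv ℝ ψ y ∘L ContinuousLinearMap.inr ℝ E E') y.2 :=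
    HasFDerivAt.comp y.2 (g := ψ) hd (hasFDerivAt_prodMk_right y.1 y.2)
  have h2 := h1.congr_of_eventuallyEq (f₁ := fun f ↦ f) (h.eq_id.mono fun f hf ↦ hf.symm)
  exact DFunLike.congr_fun (h2.unique (hasFDerivAt_id y.2)) w

/-- The velocity of a family of isometries is a Killing field. -/
theorem IsIsometryFamily.killing {ψ : E × E' → E'} (h : IsIsometryFamily GF ψ y)
    (hF : DifferentiableAt ℝ GF y.2) (v : E) (w w' : E') :
    fderiv ℝ GF y.2 (fderiv ℝ ψ y (v, 0)) w w'
      + GF y.2 (fderiv ℝ (fderiv ℝ ψ) y (0, w) (v, 0)) w'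
      + GF y.2 w (fderiv ℝ (fderiv ℝ ψ) y (0, w') (v, 0)) = 0 := by
  have d0 := (h.contDiffAt.differentiableAt (by norm_num)).hasFDerivAt
  have d1 : DifferentiableAt ℝ (fderiv ℝ ψ) y :=
    (h.contDiffAt.fderiv_right (m := 1) (by norm_num)).differentiableAt (by norm_num)
  have sy := isSymmSndFDerivAt_of_contDiffAt h.contDiffAt
  have hψy : ψ y = y.2 := h.eq_id.self_of_nhds
  have dF : HasFDerivAt GF (fderiv ℝ GF y.2) (ψ y) := by rw [hψy]; exact hF.hasFDerivAt
  have a1 := ((dF.comp y d0).clm_apply (hasFDerivAt_clm_apply_const d1 (0, w))).clm_apply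
    (hasFDerivAt_clm_apply_const d1 (0, w'))
  -- The right-hand side of the isometry identity depends on `z.2` alone, so its derivative in the
  -- direction `(v, 0)` vanishes.
  have a2 := ((hF.hasFDerivAt.comp y (hasFDerivAt_snd (p := y))).clm_apply
    (hasFDerivAt_const w y)).clm_apply (hasFDerivAt_const w' y)
  have a3 := a2.congr_of_eventuallyEq (f₁ := fun z ↦ GF (ψ z) (fderiv ℝ ψ z (0, w))
    (fderiv ℝ ψ z (0, w'))) (h.isometry.mono fun z hz ↦ hz w w')
  have := DFunLike.congr_fun (a1.unique a3) ((v, 0) : E × E')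
  simp [h.fderiv_vert, hψy] at this
  rw [sy.eq (0, w), sy.eq (0, w')]
  linarith

variable {κ : Type*} [Fintype κ]

/-- The connection form obtained by averaging the velocities of families of isometries. -/
def gaugeForm (ψ : κ → E → E × E' → E') (r : κ → E → ℝ) (y : E × E') : E →L[ℝ] E' :=
  ∑ i, r i y.1 • (fderiv ℝ (ψ i y.1) y ∘L ContinuousLinearMap.inl ℝ E E')

theorem gaugeForm_apply (ψ : κ → E → E × E' → E') (r : κ → E → ℝ) (y : E × E') (v : E) :
    gaugeForm ψ r y v = ∑ i, r i y.1 • fderiv ℝ (ψ i y.1) y (v, 0) := by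
  simp [gaugeForm, sum_apply]

variable {ψ : κ → E → E × E' → E'} {r : κ → E → ℝ}

/-- The family `ψ i` needs to be smooth only where its weight is not locally zero, that is, where
the corresponding trivialization is defined. -/
theorem contDiffAt_gaugeForm
    (h : ∀ i, (∀ᶠ b in 𝓝 y.1, r i b = 0) ∨
      (ContDiffAt ℝ ∞ (r i) y.1 ∧ ContDiffAt ℝ ∞ (Function.uncurry (ψ i)) (y.1, y))) :
    ContDiffAt ℝ ∞ (gaugeForm ψ r) y := by
  refine ContDiffAt.sum fun i _ ↦ ?_
  rcases h i with h0 | ⟨h1, h2⟩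
  · refine (contDiffAt_const (c := (0 : E →L[ℝ] E'))).congr_of_eventuallyEq ?_
    filter_upwards [(continuous_fst.tendsto y).eventually h0] with z hz
    simp [hz]
  · have h3 : ContDiffAt ℝ ∞ (fun z : E × E' ↦ r i z.1) y := h1.comp y contDiffAt_fst
    -- The derivative is taken in the second argument only, with the first frozen at the base point;
    -- joint smoothness of `ψ i` gives smooth dependence on both.
    have h4 : ContDiffAt ℝ ∞ (fun z : E × E' ↦ fderiv ℝ (ψ i z.1) z) y := by
      have h5 : ContDiffAt ℝ ∞ (Function.uncurry (fun z : E × E' ↦ ψ i z.1)) (y, y) := by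
        have h6 : ContDiffAt ℝ ∞ (fun q : (E × E') × (E × E') ↦ (q.1.1, q.2)) (y, y) := by fun_prop
        exact ContDiffAt.comp (y, y) (g := Function.uncurry (ψ i)) h2 h6
      exact ContDiffAt.fderiv (f := fun z : E × E' ↦ ψ i z.1) (g := fun z ↦ z) h5 contDiffAt_id
        (by simp)
    exact h3.smul (h4.clm_comp contDiffAt_const)

/-- Each differential restricts to the identity on vertical vectors and the weights sum to one, so
their average is a projection to the vertical space, with connection form `gaugeForm`. -/
theorem sum_smul_fderiv_eq (hr : ∑ i, r i y.1 = 1)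
    (h : ∀ i, r i y.1 ≠ 0 → IsIsometryFamily GF (ψ i y.1) y) (X : E × E') :
    ∑ i, r i y.1 • fderiv ℝ (ψ i y.1) y X = X.2 + gaugeForm ψ r y X.1 := by
  have h1 : ∀ i, r i y.1 • fderiv ℝ (ψ i y.1) y X =
      r i y.1 • X.2 + r i y.1 • fderiv ℝ (ψ i y.1) y (X.1, 0) := by
    intro i
    by_cases h0 : r i y.1 = 0
    · simp [h0]
    · rw [← smul_add]
      congr 1
      have e : X = (0, X.2) + (X.1, 0) := by simp
      conv_lhs => rw [e]
      rw [map_add, (h i h0).fderiv_vert]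
  rw [gaugeForm_apply, Finset.sum_congr rfl fun i _ ↦ h1 i, Finset.sum_add_distrib,
    ← Finset.sum_smul, hr, one_smul]

/-- The Killing equation is linear and involves derivatives along the fibre only. The weights depend
on the base point alone and behave as constants, so the average of Killing fields is again Killing.
-/
theorem isKillingForm_gaugeForm (hF : DifferentiableAt ℝ GF y.2)
    (hd : DifferentiableAt ℝ (gaugeForm ψ r) y)
    (h : ∀ i, r i y.1 ≠ 0 → IsIsometryFamily GF (ψ i y.1) y) :
    IsKillingForm GF (gaugeForm ψ r) y := by
  intro v w w'
  have key (w : E') : fderiv ℝ (gaugeForm ψ r) y (0, w) v =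
      ∑ i, r i y.1 • fderiv ℝ (fderiv ℝ (ψ i y.1)) y (0, w) (v, 0) := by
    have a1 : HasFDerivAt (fun f ↦ gaugeForm ψ r (y.1, f) v)
        ((fderiv ℝ (gaugeForm ψ r) y).flip v ∘L ContinuousLinearMap.inr ℝ E E') y.2 :=
      HasFDerivAt.comp y.2 (g := fun z ↦ gaugeForm ψ r z v) (hasFDerivAt_clm_apply_const hd v)
        (hasFDerivAt_prodMk_right y.1 y.2)
    have a2 : HasFDerivAt (fun f ↦ gaugeForm ψ r (y.1, f) v)
        (∑ i, r i y.1 • ((fderiv ℝ (fderiv ℝ (ψ i y.1)) y).flip (v, 0) ∘L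
          ContinuousLinearMap.inr ℝ E E')) y.2 := by
      simp only [gaugeForm_apply]
      refine HasFDerivAt.fun_sum fun i _ ↦ ?_
      by_cases h0 : r i y.1 = 0
      · simp only [h0, zero_smul]
        exact hasFDerivAt_const _ _
      · refine HasFDerivAt.const_smul ?_ _
        have d1 : DifferentiableAt ℝ (fderiv ℝ (ψ i y.1)) y :=
          ((h i h0).contDiffAt.fderiv_right (m := 1) (by norm_num)).differentiableAt (by norm_num)
        exact HasFDerivAt.comp y.2 (g := fun z ↦ fderiv ℝ (ψ i y.1) z (v, 0))
          (hasFDerivAt_clm_apply_const d1 (v, 0)) (hasFDerivAt_prodMk_right y.1 y.2)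
    have := DFunLike.congr_fun (a1.unique a2) w
    simpa [sum_apply] using this
  rw [key, key, gaugeForm_apply]
  simp only [map_sum, sum_apply, map_smul, smul_apply]
  rw [← Finset.sum_add_distrib, ← Finset.sum_add_distrib]
  refine Finset.sum_eq_zero fun i _ ↦ ?_
  by_cases h0 : r i y.1 = 0
  · simp [h0]
  · rw [← smul_add, ← smul_add, (h i h0).killing hF, smul_zero]

end Gauge

/-! ### The averaged connection and adapted charts -/

namespace FiberBundleWithGroup

set_option linter.unusedSectionVars false

variable {EM EB EF EG : Type*}
  [NormedAddCommGroup EM] [NormedSpace ℝ EM] [NormedAddCommGroup EB] [NormedSpace ℝ EB]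
  [NormedAddCommGroup EF] [NormedSpace ℝ EF] [NormedAddCommGroup EG] [NormedSpace ℝ EG]
  {M B F G ι : Type*}
  [TopologicalSpace M] [ChartedSpace EM M]
  [TopologicalSpace B] [ChartedSpace EB B]
  [TopologicalSpace F] [ChartedSpace EF F]
  [TopologicalSpace G] [ChartedSpace EG G] [Group G] [MulAction G F]
  {π : M → B} (H : FiberBundleWithGroup EM EB EF EG F G ι π)

/-- The fibre component of a local trivialization. -/
def fibreCoord (i : ι) (m : M) : F := (H.triv i m).2

theorem mem_nhds_baseSet {i : ι} {b : B} (hi : b ∈ (H.triv i).baseSet) :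
    (H.triv i).baseSet ∈ 𝓝 b := (H.triv i).open_baseSet.mem_nhds hi

theorem contMDiffAt_triv {i : ι} {m : M} (hi : π m ∈ (H.triv i).baseSet) :
    ContMDiffAt 𝓘(ℝ, EM) (𝓘(ℝ, EB).prod 𝓘(ℝ, EF)) ∞ (H.triv i) m :=
  (H.contMDiffOn_triv i).contMDiffAt
    ((H.triv i).open_source.mem_nhds ((H.triv i).mem_source.2 hi))

theorem contMDiff_proj (H : FiberBundleWithGroup EM EB EF EG F G ι π) : ContMDiff 𝓘(ℝ, EM) 𝓘(ℝ, EB) ∞ π := by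
  intro m
  obtain ⟨i, hi⟩ := H.cover (π m)
  refine (contMDiffAt_fst.comp m (H.contMDiffAt_triv hi)).congr_of_eventuallyEq ?_
  filter_upwards [(H.triv i).open_source.mem_nhds ((H.triv i).mem_source.2 hi)] with x hx
  exact ((H.triv i).coe_fst hx).symm

theorem contMDiffAt_fibreCoord {i : ι} {m : M} (hi : π m ∈ (H.triv i).baseSet) :
    ContMDiffAt 𝓘(ℝ, EM) 𝓘(ℝ, EF) ∞ (H.fibreCoord i) m :=
  contMDiffAt_snd.comp m (H.contMDiffAt_triv hi)

theorem fibreCoord_change {i j : ι} {m : M} (hi : π m ∈ (H.triv i).baseSet)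
    (hj : π m ∈ (H.triv j).baseSet) :
    H.fibreCoord j m = H.transition i j (π m) • H.fibreCoord i m := by
  rw [← H.coordChange_eq i j _ ⟨hi, hj⟩]
  exact ((H.triv i).coordChange_apply_snd (H.triv j) hi).symm

theorem transition_mul_transition {i j : ι} {b : B} (hi : b ∈ (H.triv i).baseSet)
    (hj : b ∈ (H.triv j).baseSet) : H.transition i j b * H.transition j i b = 1 := by
  have h := H.cocycle j j j b ⟨⟨hj, hj⟩, hj⟩
  rw [H.cocycle j i j b ⟨⟨hj, hi⟩, hj⟩]
  exact mul_eq_left.1 h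

theorem contMDiffAt_transition {i j : ι} {b : B} (hi : b ∈ (H.triv i).baseSet)
    (hj : b ∈ (H.triv j).baseSet) : ContMDiffAt 𝓘(ℝ, EB) 𝓘(ℝ, EG) ∞ (H.transition i j) b :=
  (H.contMDiffOn_transition i j).contMDiffAt
    (inter_mem (H.mem_nhds_baseSet hi) (H.mem_nhds_baseSet hj))

theorem eventually_mem_baseSet {i : ι} {m : M} (hi : π m ∈ (H.triv i).baseSet) :
    ∀ᶠ m' in 𝓝 m, π m' ∈ (H.triv i).baseSet :=
  (H.contMDiff_proj.continuous.tendsto m).eventually (H.mem_nhds_baseSet hi)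

/-! ### The vertical form of the averaged connection -/

variable {κ : Type*} [Fintype κ] (ρ : κ → B → ℝ) (c : κ → ι)

/-- The vertical projection of the connection obtained by averaging the flat connections of the
local trivializations `c k` with weights `ρ k`, read in the trivialization `j`. -/
def vertForm (j : ι) (m : M) : EM →L[ℝ] EF :=
  ∑ k, ρ k (π m) • (mder (fun m' ↦ H.transition (c k) j (π m) • H.fibreCoord (c k) m') m :
    EM →L[ℝ] EF)

theorem contMDiff_const_smul [ContMDiffSMul 𝓘(ℝ, EG) 𝓘(ℝ, EF) ∞ G F] (a : G) :
    ContMDiff 𝓘(ℝ, EF) 𝓘(ℝ, EF) ∞ (fun x : F ↦ a • x) :=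
  ContMDiffSMul.contMDiff_const_smul (I := 𝓘(ℝ, EG)) a

/-- The transition functions inside `vertForm` are frozen at `π m`. By the cocycle identity, passing
from `i` to `j` composes each summand with the action of one fixed group element, and no derivative
of a transition function appears. -/
theorem vertForm_change [ContMDiffSMul 𝓘(ℝ, EG) 𝓘(ℝ, EF) ∞ G F]
    (hρ : ∀ k b, ρ k b ≠ 0 → b ∈ (H.triv (c k)).baseSet) {i j : ι} {m : M}
    (hi : π m ∈ (H.triv i).baseSet) (hj : π m ∈ (H.triv j).baseSet) :
    H.vertForm ρ c j m = (mder (fun x : F ↦ H.transition i j (π m) • x) (H.fibreCoord i m) :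
      EF →L[ℝ] EF) ∘L H.vertForm ρ c i m := by
  refine ContinuousLinearMap.ext fun v ↦ ?_
  simp only [vertForm, sum_apply, ContinuousLinearMap.comp_apply, map_sum, smul_apply, map_smul]
  refine Finset.sum_congr rfl fun k _ ↦ ?_
  by_cases h0 : ρ k (π m) = 0
  · simp [h0]
  congr 1
  have hk := hρ k _ h0
  have hs (a : G) := contMDiff_const_smul (EG := EG) (EF := EF) (F := F) a
  have e : (fun m' ↦ H.transition (c k) j (π m) • H.fibreCoord (c k) m') =
      fun m' ↦ H.transition i j (π m) • (H.transition (c k) i (π m) • H.fibreCoord (c k) m') := by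
    funext m'
    rw [smul_smul, H.cocycle _ _ _ _ ⟨⟨hk, hi⟩, hj⟩]
  rw [e, mder_comp (g := fun x : F ↦ H.transition i j (π m) • x)
    (f := fun m' ↦ H.transition (c k) i (π m) • H.fibreCoord (c k) m') (E' := EF),
    ← H.fibreCoord_change hk hi]
  · rfl
  · exact (hs _).contMDiffAt.mdifferentiableAt (by simp)
  · exact ((hs _).contMDiffAt.comp m (H.contMDiffAt_fibreCoord hk)).mdifferentiableAt (by simp)

variable [IsManifold 𝓘(ℝ, EM) ∞ M] [IsManifold 𝓘(ℝ, EB) ∞ B] [IsManifold 𝓘(ℝ, EF) ∞ F]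
  (gB : RiemMetric EB B) (gF : RiemMetric EF F)

/-- The connection metric on the total space, computed in the trivialization `j`. -/
def connForm (s : ℝ) (j : ι) (m : M) : EM →L[ℝ] EM →L[ℝ] ℝ :=
  (metricForm gB (π m)).bilinearComp (mder π m : EM →L[ℝ] EB) (mder π m : EM →L[ℝ] EB)
    + s • (metricForm gF (H.fibreCoord j m)).bilinearComp (H.vertForm ρ c j m) (H.vertForm ρ c j m)

theorem connForm_apply (s : ℝ) (j : ι) (m : M) (v w : EM) :
    H.connForm ρ c gB gF s j m v w =
      metricForm gB (π m) ((mder π m : EM →L[ℝ] EB) v) ((mder π m : EM →L[ℝ] EB) w)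
      + s * metricForm gF (H.fibreCoord j m) (H.vertForm ρ c j m v) (H.vertForm ρ c j m w) := rfl

theorem metricForm_smul {gF : RiemMetric EF F} (hF : IsInvariantMetric G gF) (a : G) (x : F)
    (v w : EF) :
    metricForm gF (a • x) ((mder (fun y : F ↦ a • y) x : EF →L[ℝ] EF) v)
      ((mder (fun y : F ↦ a • y) x : EF →L[ℝ] EF) w) = metricForm gF x v w := hF a x v w

/-- Changing the trivialization moves both the fibre point and the vertical projection by the same
group element, which is an isometry of `gF`. -/
theorem connForm_eq [ContMDiffSMul 𝓘(ℝ, EG) 𝓘(ℝ, EF) ∞ G F]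
    (hρ : ∀ k b, ρ k b ≠ 0 → b ∈ (H.triv (c k)).baseSet) {gF : RiemMetric EF F}
    (hF : IsInvariantMetric G gF) (s : ℝ) {i j : ι} {m : M}
    (hi : π m ∈ (H.triv i).baseSet) (hj : π m ∈ (H.triv j).baseSet) :
    H.connForm ρ c gB gF s i m = H.connForm ρ c gB gF s j m := by
  refine ContinuousLinearMap.ext fun v ↦ ContinuousLinearMap.ext fun w ↦ ?_
  rw [connForm_apply, connForm_apply, H.vertForm_change ρ c hρ hi hj, H.fibreCoord_change hi hj,
    ContinuousLinearMap.comp_apply, ContinuousLinearMap.comp_apply, metricForm_smul hF]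

/-! ### Charts of the total space adapted to a trivialization -/

/-- The chart of the total space around `m₀` induced by the trivialization `j`. -/
def trivChart (j : ι) (m₀ m : M) : EB × EF :=
  (extChartAt 𝓘(ℝ, EB) (π m₀) (π m),
    extChartAt 𝓘(ℝ, EF) (H.fibreCoord j m₀) (H.fibreCoord j m))

variable {j : ι} {m₀ : M}

theorem contMDiffAt_trivChart_fst (H : FiberBundleWithGroup EM EB EF EG F G ι π) :
    ContMDiffAt 𝓘(ℝ, EM) 𝓘(ℝ, EB) ∞ (fun m ↦ extChartAt 𝓘(ℝ, EB) (π m₀) (π m)) m₀ :=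
  (contMDiffAt_extChartAt_of_mem (mem_extChartAt_source _)).comp m₀ H.contMDiff_proj.contMDiffAt

theorem contMDiffAt_trivChart_snd (hj : π m₀ ∈ (H.triv j).baseSet) :
    ContMDiffAt 𝓘(ℝ, EM) 𝓘(ℝ, EF) ∞
      (fun m ↦ extChartAt 𝓘(ℝ, EF) (H.fibreCoord j m₀) (H.fibreCoord j m)) m₀ :=
  (contMDiffAt_extChartAt_of_mem (mem_extChartAt_source _)).comp m₀ (H.contMDiffAt_fibreCoord hj)

theorem contMDiffAt_trivChart (hj : π m₀ ∈ (H.triv j).baseSet) :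
    ContMDiffAt 𝓘(ℝ, EM) 𝓘(ℝ, EB × EF) ∞ (H.trivChart j m₀) m₀ :=
  H.contMDiffAt_trivChart_fst.prodMk_space (H.contMDiffAt_trivChart_snd hj)

/-- The inverse of `trivChart`. -/
def trivChartSymm (j : ι) (m₀ : M) (y : EB × EF) : M :=
  (H.triv j).toOpenPartialHomeomorph.symm ((extChartAt 𝓘(ℝ, EB) (π m₀)).symm y.1,
    (extChartAt 𝓘(ℝ, EF) (H.fibreCoord j m₀)).symm y.2)

theorem trivChartSymm_trivChart (hj : π m₀ ∈ (H.triv j).baseSet) :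
    ∀ᶠ m in 𝓝 m₀, H.trivChartSymm j m₀ (H.trivChart j m₀ m) = m := by
  filter_upwards [H.eventually_mem_baseSet hj,
    (H.contMDiff_proj.continuous.tendsto m₀).eventually
      (extChartAt_source_mem_nhds (I := 𝓘(ℝ, EB)) (π m₀)),
    ((H.contMDiffAt_fibreCoord hj).continuousAt).eventually
      (extChartAt_source_mem_nhds (I := 𝓘(ℝ, EF)) (H.fibreCoord j m₀))] with m h1 h2 h3
  rw [trivChartSymm, trivChart, (extChartAt 𝓘(ℝ, EB) (π m₀)).left_inv h2,
    (extChartAt 𝓘(ℝ, EF) (H.fibreCoord j m₀)).left_inv h3]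
  exact (H.triv j).symm_apply_mk_proj ((H.triv j).mem_source.2 h1)

theorem contMDiffAt_trivChartSymm (hj : π m₀ ∈ (H.triv j).baseSet) :
    ContMDiffAt 𝓘(ℝ, EB × EF) 𝓘(ℝ, EM) ∞ (H.trivChartSymm j m₀) (H.trivChart j m₀ m₀) := by
  have h1 : ContMDiffAt 𝓘(ℝ, EB × EF) 𝓘(ℝ, EB) ∞
      (fun y : EB × EF ↦ (extChartAt 𝓘(ℝ, EB) (π m₀)).symm y.1) (H.trivChart j m₀ m₀) :=
    ContMDiffAt.comp _ (contMDiffAt_extChartAt_symm_of_mem (mem_extChartAt_target (π m₀)))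
      contDiffAt_fst.contMDiffAt
  have h2 : ContMDiffAt 𝓘(ℝ, EB × EF) 𝓘(ℝ, EF) ∞
      (fun y : EB × EF ↦ (extChartAt 𝓘(ℝ, EF) (H.fibreCoord j m₀)).symm y.2)
      (H.trivChart j m₀ m₀) :=
    ContMDiffAt.comp _ (contMDiffAt_extChartAt_symm_of_mem
      (mem_extChartAt_target (H.fibreCoord j m₀))) contDiffAt_snd.contMDiffAt
  refine ContMDiffAt.comp _ ((H.contMDiffOn_triv_symm j).contMDiffAt
    ((H.triv j).open_target.mem_nhds ?_)) (h1.prodMk h2)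
  rw [(H.triv j).mem_target, trivChart, extChartAt_to_inv]
  exact hj

theorem trivChart_trivChartSymm (hj : π m₀ ∈ (H.triv j).baseSet) :
    ∀ᶠ y in 𝓝 (H.trivChart j m₀ m₀), H.trivChart j m₀ (H.trivChartSymm j m₀ y) = y := by
  have t1 : ∀ᶠ y in 𝓝 (H.trivChart j m₀ m₀), y.1 ∈ (extChartAt 𝓘(ℝ, EB) (π m₀)).target :=
    (continuous_fst.tendsto _).eventually (extChartAt_target_mem_nhds (I := 𝓘(ℝ, EB)) (π m₀))
  have t2 : ∀ᶠ y in 𝓝 (H.trivChart j m₀ m₀),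
      y.2 ∈ (extChartAt 𝓘(ℝ, EF) (H.fibreCoord j m₀)).target :=
    (continuous_snd.tendsto _).eventually
      (extChartAt_target_mem_nhds (I := 𝓘(ℝ, EF)) (H.fibreCoord j m₀))
  have t3 : ∀ᶠ y in 𝓝 (H.trivChart j m₀ m₀),
      (extChartAt 𝓘(ℝ, EB) (π m₀)).symm y.1 ∈ (H.triv j).baseSet := by
    have : Tendsto (fun y : EB × EF ↦ (extChartAt 𝓘(ℝ, EB) (π m₀)).symm y.1)
        (𝓝 (H.trivChart j m₀ m₀)) (𝓝 (π m₀)) := by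
      have h := (continuousAt_extChartAt_symm (I := 𝓘(ℝ, EB)) (π m₀))
      rw [ContinuousAt, extChartAt_to_inv] at h
      exact h.comp (continuous_fst.tendsto (H.trivChart j m₀ m₀))
    exact this.eventually (H.mem_nhds_baseSet hj)
  filter_upwards [t1, t2, t3] with y h1 h2 h3
  have h4 := (H.triv j).apply_symm_apply' (b := (extChartAt 𝓘(ℝ, EB) (π m₀)).symm y.1) h3
    (x := (extChartAt 𝓘(ℝ, EF) (H.fibreCoord j m₀)).symm y.2)
  have h5 := (H.triv j).proj_symm_apply' (b := (extChartAt 𝓘(ℝ, EB) (π m₀)).symm y.1) h3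
    (x := (extChartAt 𝓘(ℝ, EF) (H.fibreCoord j m₀)).symm y.2)
  have h6 : H.fibreCoord j ((H.triv j).toOpenPartialHomeomorph.symm
      ((extChartAt 𝓘(ℝ, EB) (π m₀)).symm y.1,
        (extChartAt 𝓘(ℝ, EF) (H.fibreCoord j m₀)).symm y.2)) = _ := congrArg Prod.snd h4
  rw [trivChart, trivChartSymm, h5, h6, (extChartAt 𝓘(ℝ, EB) (π m₀)).right_inv h1,
    (extChartAt 𝓘(ℝ, EF) (H.fibreCoord j m₀)).right_inv h2]

theorem isInvertible_mder_trivChart (hj : π m₀ ∈ (H.triv j).baseSet) :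
    ∀ᶠ m in 𝓝 m₀, (mder (H.trivChart j m₀) m : EM →L[ℝ] EB × EF).IsInvertible := by
  have hc := (H.contMDiffAt_trivChart hj).continuousAt
  filter_upwards [(H.trivChartSymm_trivChart hj).eventually_nhds,
    hc.eventually (H.trivChart_trivChartSymm hj).eventually_nhds,
    eventually_contMDiffAt (H.contMDiffAt_trivChart hj),
    hc.eventually (eventually_contMDiffAt (H.contMDiffAt_trivChartSymm hj))] with m h1 h2 h3 h4
  have d3 := h3.mdifferentiableAt (by simp)
  have d4 := h4.mdifferentiableAt (by simp)
  have e1 := mder_comp d4 d3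
  have hm := h1.self_of_nhds
  have e2 := mder_comp (g := H.trivChart j m₀) (f := H.trivChartSymm j m₀)
    (x := H.trivChart j m₀ m) (by rwa [hm]) d4
  rw [hm] at e2
  refine ContinuousLinearMap.IsInvertible.of_inverse
    (g := (mder (H.trivChartSymm j m₀) (H.trivChart j m₀ m) : EB × EF →L[ℝ] EM)) ?_ ?_
  · rw [← e2, mder_congr (g := fun z ↦ z) h2]
    exact mder_id _
  · rw [← e1, mder_congr (g := fun z ↦ z) h1]
    exact mder_id _

end FiberBundleWithGroup

/-! ### Transition functions as families of fibre isometries -/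

namespace FiberBundleWithGroup

set_option linter.unusedSectionVars false

variable {EM EB EF EG : Type*}
  [NormedAddCommGroup EM] [NormedSpace ℝ EM] [NormedAddCommGroup EB] [NormedSpace ℝ EB]
  [NormedAddCommGroup EF] [NormedSpace ℝ EF] [NormedAddCommGroup EG] [NormedSpace ℝ EG]
  {M B F G ι : Type*}
  [TopologicalSpace M] [ChartedSpace EM M] [IsManifold 𝓘(ℝ, EM) ∞ M]
  [TopologicalSpace B] [ChartedSpace EB B] [IsManifold 𝓘(ℝ, EB) ∞ B]
  [TopologicalSpace F] [ChartedSpace EF F] [IsManifold 𝓘(ℝ, EF) ∞ F]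
  [TopologicalSpace G] [ChartedSpace EG G] [Group G] [MulAction G F]
  {π : M → B} (H : FiberBundleWithGroup EM EB EF EG F G ι π)

/-! ### Transition functions in charts -/

/-- The point of the fibre obtained by passing from the trivialization `j` to `i` over one point of
the base and back over another one. -/
def gaugePoint (i j : ι) (m₀ : M) (q : EB × (EB × EF)) : F :=
  H.transition i j ((extChartAt 𝓘(ℝ, EB) (π m₀)).symm q.1) •
    H.transition j i ((extChartAt 𝓘(ℝ, EB) (π m₀)).symm q.2.1) •
      (extChartAt 𝓘(ℝ, EF) (H.fibreCoord j m₀)).symm q.2.2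

/-- The map `gaugePoint`, read in a chart of the fibre. -/
def gaugeMap (i j : ι) (m₀ : M) (b : EB) (z : EB × EF) : EF :=
  extChartAt 𝓘(ℝ, EF) (H.fibreCoord j m₀) (H.gaugePoint i j m₀ (b, z))

theorem gaugePoint_self {i j : ι} {m₀ : M} {b : EB}
    (hi : (extChartAt 𝓘(ℝ, EB) (π m₀)).symm b ∈ (H.triv i).baseSet)
    (hj : (extChartAt 𝓘(ℝ, EB) (π m₀)).symm b ∈ (H.triv j).baseSet) (f : EF) :
    H.gaugePoint i j m₀ (b, (b, f)) = (extChartAt 𝓘(ℝ, EF) (H.fibreCoord j m₀)).symm f := by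
  rw [gaugePoint, smul_smul, H.transition_mul_transition hi hj, one_smul]

variable {i j : ι} {m₀ : M}

theorem gaugePoint_center (hi : π m₀ ∈ (H.triv i).baseSet) (hj : π m₀ ∈ (H.triv j).baseSet) :
    H.gaugePoint i j m₀ ((H.trivChart j m₀ m₀).1, H.trivChart j m₀ m₀) = H.fibreCoord j m₀ := by
  have hb : (extChartAt 𝓘(ℝ, EB) (π m₀)).symm (extChartAt 𝓘(ℝ, EB) (π m₀) (π m₀)) = π m₀ :=
    extChartAt_to_inv (π m₀)
  rw [trivChart, H.gaugePoint_self (by rwa [hb]) (by rwa [hb]), extChartAt_to_inv]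

variable [ContMDiffSMul 𝓘(ℝ, EG) 𝓘(ℝ, EF) ∞ G F]

theorem contMDiffAt_gaugePoint (hi : π m₀ ∈ (H.triv i).baseSet)
    (hj : π m₀ ∈ (H.triv j).baseSet) :
    ContMDiffAt 𝓘(ℝ, EB × (EB × EF)) 𝓘(ℝ, EF) ∞ (H.gaugePoint i j m₀)
      ((H.trivChart j m₀ m₀).1, H.trivChart j m₀ m₀) := by
  set q₀ : EB × (EB × EF) := ((H.trivChart j m₀ m₀).1, H.trivChart j m₀ m₀) with hq₀
  have hb : (extChartAt 𝓘(ℝ, EB) (π m₀)).symm (extChartAt 𝓘(ℝ, EB) (π m₀) (π m₀)) = π m₀ :=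
    extChartAt_to_inv (π m₀)
  have hB := contMDiffAt_extChartAt_symm_of_mem (mem_extChartAt_target (I := 𝓘(ℝ, EB)) (π m₀))
  have hF := contMDiffAt_extChartAt_symm_of_mem
    (mem_extChartAt_target (I := 𝓘(ℝ, EF)) (H.fibreCoord j m₀))
  have p1 : ContMDiffAt 𝓘(ℝ, EB × (EB × EF)) 𝓘(ℝ, EB) ∞ (fun q : EB × (EB × EF) ↦ q.1) q₀ :=
    ContDiffAt.contMDiffAt (by fun_prop)
  have p2 : ContMDiffAt 𝓘(ℝ, EB × (EB × EF)) 𝓘(ℝ, EB) ∞ (fun q : EB × (EB × EF) ↦ q.2.1) q₀ :=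
    ContDiffAt.contMDiffAt (by fun_prop)
  have p3 : ContMDiffAt 𝓘(ℝ, EB × (EB × EF)) 𝓘(ℝ, EF) ∞ (fun q : EB × (EB × EF) ↦ q.2.2) q₀ :=
    ContDiffAt.contMDiffAt (by fun_prop)
  have t1 := ContMDiffAt.comp_of_eq (H.contMDiffAt_transition hi hj)
    (ContMDiffAt.comp q₀ hB p1) hb
  have t2 := ContMDiffAt.comp_of_eq (H.contMDiffAt_transition hj hi)
    (ContMDiffAt.comp q₀ hB p2) hb
  exact t1.smul (t2.smul (ContMDiffAt.comp q₀ hF p3))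

theorem contDiffAt_gaugeMap (hi : π m₀ ∈ (H.triv i).baseSet) (hj : π m₀ ∈ (H.triv j).baseSet) :
    ContDiffAt ℝ ∞ (Function.uncurry (H.gaugeMap i j m₀))
      ((H.trivChart j m₀ m₀).1, H.trivChart j m₀ m₀) :=
  contMDiffAt_iff_contDiffAt.1 (ContMDiffAt.comp_of_eq
    (contMDiffAt_extChartAt_of_mem (mem_extChartAt_source (H.fibreCoord j m₀)))
    (H.contMDiffAt_gaugePoint hi hj) (H.gaugePoint_center hi hj))

/-- With both base points fixed, `gaugePoint` is the action of a single element of `G`, and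
`chartMetric` is `gF` read in the chart. -/
theorem gaugeMap_isometry {gF : RiemMetric EF F} (hF : IsInvariantMetric G gF) {b : EB}
    {z : EB × EF} (hd : DifferentiableAt ℝ (H.gaugeMap i j m₀ b) z)
    (ht : z.2 ∈ (extChartAt 𝓘(ℝ, EF) (H.fibreCoord j m₀)).target)
    (hs : H.gaugePoint i j m₀ (b, z) ∈ (extChartAt 𝓘(ℝ, EF) (H.fibreCoord j m₀)).source)
    (w w' : EF) :
    chartMetric gF (H.fibreCoord j m₀) (H.gaugeMap i j m₀ b z)
      (fderiv ℝ (H.gaugeMap i j m₀ b) z (0, w)) (fderiv ℝ (H.gaugeMap i j m₀ b) z (0, w')) =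
    chartMetric gF (H.fibreCoord j m₀) z.2 w w' := by
  set χ := extChartAt 𝓘(ℝ, EF) (H.fibreCoord j m₀) with hχ
  let a : G := H.transition i j ((extChartAt 𝓘(ℝ, EB) (π m₀)).symm b) *
    H.transition j i ((extChartAt 𝓘(ℝ, EB) (π m₀)).symm z.1)
  have ha (f : EF) : H.gaugePoint i j m₀ (b, (z.1, f)) = a • χ.symm f := by
    rw [gaugePoint, smul_smul]
  have hax : a • χ.symm z.2 ∈ χ.source := by rw [← ha]; exact hs
  have h1 : HasFDerivAt (fun f ↦ H.gaugeMap i j m₀ b (z.1, f))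
      (fderiv ℝ (H.gaugeMap i j m₀ b) z ∘L ContinuousLinearMap.inr ℝ EB EF) z.2 :=
    HasFDerivAt.comp z.2 (g := H.gaugeMap i j m₀ b) hd.hasFDerivAt
      (hasFDerivAt_prodMk_right z.1 z.2)
  have d1 : MDifferentiableAt 𝓘(ℝ, EF) 𝓘(ℝ, EF) χ.symm z.2 :=
    (contMDiffAt_extChartAt_symm_of_mem ht).mdifferentiableAt (by simp)
  have d2 : MDifferentiableAt 𝓘(ℝ, EF) 𝓘(ℝ, EF) (fun x : F ↦ a • x) (χ.symm z.2) :=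
    (contMDiff_const_smul (EG := EG) a).contMDiffAt.mdifferentiableAt (by simp)
  have d3 : MDifferentiableAt 𝓘(ℝ, EF) 𝓘(ℝ, EF) χ (a • χ.symm z.2) :=
    (contMDiffAt_extChartAt_of_mem hax).mdifferentiableAt (by simp)
  have h2 (w : EF) : fderiv ℝ (H.gaugeMap i j m₀ b) z (0, w) =
      (mder χ (a • χ.symm z.2) : EF →L[ℝ] EF) ((mder (fun x : F ↦ a • x) (χ.symm z.2) :
        EF →L[ℝ] EF) ((mder χ.symm z.2 : EF →L[ℝ] EF) w)) := by
    have e1 := DFunLike.congr_fun h1.fderiv w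
    rw [← mder_eq_fderiv] at e1
    have e2 : (fun f ↦ H.gaugeMap i j m₀ b (z.1, f)) = fun f ↦ χ (a • χ.symm f) := by
      funext f
      rw [gaugeMap, ha]
    rw [e2, mder_comp (g := χ) (f := fun f ↦ a • χ.symm f) (E' := EF) d3
      (MDifferentiableAt.comp (I' := 𝓘(ℝ, EF)) z.2 d2 d1),
      mder_comp (g := fun x : F ↦ a • x) (f := χ.symm) (E' := EF) d2 d1] at e1
    exact e1.symm
  have h3 : H.gaugeMap i j m₀ b z = χ (a • χ.symm z.2) := by rw [← ha]; rfl
  rw [h2, h2, h3, ← metricForm_eq_chartMetric gF hax, metricForm_smul hF]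
  rfl

theorem eventually_isIsometryFamily {gF : RiemMetric EF F} (hF : IsInvariantMetric G gF)
    (hi : π m₀ ∈ (H.triv i).baseSet) (hj : π m₀ ∈ (H.triv j).baseSet) :
    ∀ᶠ y in 𝓝 (H.trivChart j m₀ m₀),
      IsIsometryFamily (chartMetric gF (H.fibreCoord j m₀)) (H.gaugeMap i j m₀ y.1) y := by
  set y₀ := H.trivChart j m₀ m₀ with hy₀
  have c1 : ∀ᶠ q in 𝓝 (y₀.1, y₀), ContDiffAt ℝ 3 (Function.uncurry (H.gaugeMap i j m₀)) q :=
    ((H.contDiffAt_gaugeMap hi hj).of_le ENat.LEInfty.out).eventually (by simp)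
  have c2 : ∀ᶠ q in 𝓝 (y₀.1, y₀), q.2.2 ∈ (extChartAt 𝓘(ℝ, EF) (H.fibreCoord j m₀)).target := by
    have : Tendsto (fun q : EB × (EB × EF) ↦ q.2.2) (𝓝 (y₀.1, y₀)) (𝓝 y₀.2) :=
      (continuous_snd.comp continuous_snd).tendsto (y₀.1, y₀)
    exact this.eventually (extChartAt_target_mem_nhds (I := 𝓘(ℝ, EF)) (H.fibreCoord j m₀))
  have c3 : ∀ᶠ q in 𝓝 (y₀.1, y₀),
      H.gaugePoint i j m₀ q ∈ (extChartAt 𝓘(ℝ, EF) (H.fibreCoord j m₀)).source := by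
    have := (H.contMDiffAt_gaugePoint hi hj).continuousAt
    rw [ContinuousAt, H.gaugePoint_center hi hj] at this
    exact this.eventually (extChartAt_source_mem_nhds (I := 𝓘(ℝ, EF)) (H.fibreCoord j m₀))
  have c4 : ∀ᶠ y in 𝓝 y₀, (extChartAt 𝓘(ℝ, EB) (π m₀)).symm y.1 ∈
      (H.triv i).baseSet ∩ (H.triv j).baseSet := by
    have h := (continuousAt_extChartAt_symm (I := 𝓘(ℝ, EB)) (π m₀))
    rw [ContinuousAt, extChartAt_to_inv] at h
    have h' : Tendsto (fun y : EB × EF ↦ (extChartAt 𝓘(ℝ, EB) (π m₀)).symm y.1) (𝓝 y₀)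
        (𝓝 (π m₀)) := h.comp (continuous_fst.tendsto y₀)
    exact h'.eventually (inter_mem (H.mem_nhds_baseSet hi) (H.mem_nhds_baseSet hj))
  have cd : Tendsto (fun y : EB × EF ↦ (y.1, y)) (𝓝 y₀) (𝓝 (y₀.1, y₀)) :=
    (continuous_fst.prodMk continuous_id).tendsto y₀
  -- Smoothness and chart conditions are open in the pair (frozen base point, variable point).
  -- Restricting to pairs `(y.1, y)` and then varying only the second entry gives them near each
  -- `y`.
  filter_upwards [cd.eventually (c1.and (c2.and c3)).eventually_nhds, c4] with y hy hy4
  have cz : Tendsto (fun z : EB × EF ↦ (y.1, z)) (𝓝 y) (𝓝 (y.1, y)) :=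
    (Continuous.prodMk_right y.1).tendsto y
  have smooth {z : EB × EF} (h : ContDiffAt ℝ 3 (Function.uncurry (H.gaugeMap i j m₀)) (y.1, z)) :
      ContDiffAt ℝ 3 (H.gaugeMap i j m₀ y.1) z :=
    ContDiffAt.comp z (g := Function.uncurry (H.gaugeMap i j m₀)) h
      (contDiffAt_const.prodMk contDiffAt_id)
  refine ⟨(smooth hy.self_of_nhds.1).of_le (by norm_num), ?_, ?_⟩
  · have h2 := hy.self_of_nhds.2.1
    filter_upwards [extChartAt_target_mem_nhds' h2] with f hf
    rw [gaugeMap, H.gaugePoint_self hy4.1 hy4.2]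
    exact (extChartAt 𝓘(ℝ, EF) (H.fibreCoord j m₀)).right_inv hf
  · filter_upwards [cz.eventually hy] with z hz w w'
    exact H.gaugeMap_isometry hF ((smooth hz.1).differentiableAt (by norm_num)) hz.2.1 hz.2.2 w w'

end FiberBundleWithGroup

/-! ### The connection metric on the total space and its Ricci curvature -/

namespace FiberBundleWithGroup

set_option linter.unusedSectionVars false

variable {EM EB EF EG : Type*}
  [NormedAddCommGroup EM] [NormedSpace ℝ EM] [NormedAddCommGroup EB] [NormedSpace ℝ EB]
  [NormedAddCommGroup EF] [NormedSpace ℝ EF] [NormedAddCommGroup EG] [NormedSpace ℝ EG]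
  {M B F G ι : Type*}
  [TopologicalSpace M] [ChartedSpace EM M] [IsManifold 𝓘(ℝ, EM) ∞ M]
  [TopologicalSpace B] [ChartedSpace EB B] [IsManifold 𝓘(ℝ, EB) ∞ B]
  [TopologicalSpace F] [ChartedSpace EF F] [IsManifold 𝓘(ℝ, EF) ∞ F]
  [TopologicalSpace G] [ChartedSpace EG G] [Group G] [MulAction G F]
  {π : M → B} (H : FiberBundleWithGroup EM EB EF EG F G ι π)
  {κ : Type*} [Fintype κ] (ρ : κ → B → ℝ) (c : κ → ι)

/-- `ρ` is a finite smooth partition of unity such that `ρ k` is supported in the base set of the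
trivialization `c k`. -/
structure IsAdaptedPartition : Prop where
  contMDiff : ∀ k, ContMDiff 𝓘(ℝ, EB) 𝓘(ℝ, ℝ) ∞ (ρ k)
  eventually_zero : ∀ k b, b ∉ (H.triv (c k)).baseSet → ∀ᶠ b' in 𝓝 b, ρ k b' = 0
  sum_eq_one : ∀ b, ∑ k, ρ k b = 1

variable {ρ c}

theorem IsAdaptedPartition.mem_baseSet (hρ : H.IsAdaptedPartition ρ c) (k : κ) (b : B)
    (h : ρ k b ≠ 0) : b ∈ (H.triv (c k)).baseSet := by
  by_contra hb
  exact h (hρ.eventually_zero k b hb).self_of_nhds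

/-- Functions whose base set misses `b` vanish near `b`. So near `b` only trivializations defined at
`b` itself contribute, and these can be handled in charts centred over `b`. -/
theorem IsAdaptedPartition.eventually_mem (hρ : H.IsAdaptedPartition ρ c) (b : B) :
    ∀ᶠ b' in 𝓝 b, ∀ k, ρ k b' ≠ 0 → b ∈ (H.triv (c k)).baseSet := by
  rw [eventually_all]
  intro k
  by_cases hb : b ∈ (H.triv (c k)).baseSet
  · exact Eventually.of_forall fun _ _ ↦ hb
  · exact (hρ.eventually_zero k b hb).mono fun b' h0 h1 ↦ absurd h0 h1

variable (ρ c)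

/-- The connection form of the averaged connection in the chart `trivChart`. -/
def localForm (j : ι) (m₀ : M) : EB × EF → EB →L[ℝ] EF :=
  gaugeForm (fun k ↦ H.gaugeMap (c k) j m₀)
    (fun k b ↦ ρ k ((extChartAt 𝓘(ℝ, EB) (π m₀)).symm b))

variable {ρ c} {j : ι} {m₀ : M} [ContMDiffSMul 𝓘(ℝ, EG) 𝓘(ℝ, EF) ∞ G F]

theorem tendsto_extChartAt_symm_fst (y : EB × EF)
    (hy : y.1 = extChartAt 𝓘(ℝ, EB) (π m₀) (π m₀)) :
    Tendsto (fun y : EB × EF ↦ (extChartAt 𝓘(ℝ, EB) (π m₀)).symm y.1) (𝓝 y) (𝓝 (π m₀)) := by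
  have h := continuousAt_extChartAt_symm (I := 𝓘(ℝ, EB)) (π m₀)
  rw [ContinuousAt, extChartAt_to_inv, ← hy] at h
  exact h.comp (continuous_fst.tendsto y)

theorem contDiffAt_localForm (hρ : H.IsAdaptedPartition ρ c) (hj : π m₀ ∈ (H.triv j).baseSet) :
    ContDiffAt ℝ ∞ (H.localForm ρ c j m₀) (H.trivChart j m₀ m₀) := by
  refine contDiffAt_gaugeForm fun k ↦ ?_
  have hb : (extChartAt 𝓘(ℝ, EB) (π m₀)).symm (extChartAt 𝓘(ℝ, EB) (π m₀) (π m₀)) = π m₀ :=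
    extChartAt_to_inv (π m₀)
  by_cases hk : π m₀ ∈ (H.triv (c k)).baseSet
  · refine Or.inr ⟨?_, H.contDiffAt_gaugeMap hk hj⟩
    exact contMDiffAt_iff_contDiffAt.1 (ContMDiffAt.comp_of_eq (hρ.contMDiff k).contMDiffAt
      (contMDiffAt_extChartAt_symm_of_mem (mem_extChartAt_target (π m₀))) hb)
  · have h := continuousAt_extChartAt_symm (I := 𝓘(ℝ, EB)) (π m₀)
    rw [ContinuousAt, extChartAt_to_inv] at h
    exact Or.inl (h.eventually (hρ.eventually_zero k _ hk))

theorem eventually_forall_isIsometryFamily {gF : RiemMetric EF F} (hF : IsInvariantMetric G gF)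
    (hρ : H.IsAdaptedPartition ρ c) (hj : π m₀ ∈ (H.triv j).baseSet) :
    ∀ᶠ y in 𝓝 (H.trivChart j m₀ m₀), ∀ k, ρ k ((extChartAt 𝓘(ℝ, EB) (π m₀)).symm y.1) ≠ 0 →
      IsIsometryFamily (chartMetric gF (H.fibreCoord j m₀)) (H.gaugeMap (c k) j m₀ y.1) y := by
  have h1 : ∀ᶠ y in 𝓝 (H.trivChart j m₀ m₀), ∀ k, π m₀ ∈ (H.triv (c k)).baseSet →
      IsIsometryFamily (chartMetric gF (H.fibreCoord j m₀)) (H.gaugeMap (c k) j m₀ y.1) y := by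
    rw [eventually_all]
    intro k
    by_cases hk : π m₀ ∈ (H.triv (c k)).baseSet
    · exact (H.eventually_isIsometryFamily hF hk hj).mono fun _ h _ ↦ h
    · exact Eventually.of_forall fun _ h ↦ absurd h hk
  filter_upwards [h1, (tendsto_extChartAt_symm_fst (H.trivChart j m₀ m₀) rfl).eventually
    (hρ.eventually_mem H (π m₀))] with y hy hy' k hk
  exact hy k (hy' k hk)

theorem isConnectionData [FiniteDimensional ℝ EB] [FiniteDimensional ℝ EF]
    (gB : RiemMetric EB B) {gF : RiemMetric EF F}
    (hF : IsInvariantMetric G gF) (hρ : H.IsAdaptedPartition ρ c)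
    (hj : π m₀ ∈ (H.triv j).baseSet) :
    IsConnectionData (chartMetric gB (π m₀)) (chartMetric gF (H.fibreCoord j m₀))
      (H.localForm ρ c j m₀) (H.trivChart j m₀ m₀) where
  base := (contDiffAt_chartMetric gB (π m₀)).of_le ENat.LEInfty.out
  fibre := (contDiffAt_chartMetric gF (H.fibreCoord j m₀)).of_le ENat.LEInfty.out
  form := (H.contDiffAt_localForm hρ hj).of_le ENat.LEInfty.out
  base_inner := by
    filter_upwards [extChartAt_target_mem_nhds (I := 𝓘(ℝ, EB)) (π m₀)] with b hb
    exact isInnerForm_chartMetric gB hb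
  fibre_inner := by
    filter_upwards [extChartAt_target_mem_nhds (I := 𝓘(ℝ, EF)) (H.fibreCoord j m₀)] with f hf
    exact isInnerForm_chartMetric gF hf
  killing := by
    have h1 : ContDiffAt ℝ 1 (H.localForm ρ c j m₀) (H.trivChart j m₀ m₀) :=
      (H.contDiffAt_localForm hρ hj).of_le ENat.LEInfty.out
    have h2 : ContDiffAt ℝ 1 (chartMetric gF (H.fibreCoord j m₀)) (H.trivChart j m₀ m₀).2 :=
      (contDiffAt_chartMetric gF (H.fibreCoord j m₀)).of_le ENat.LEInfty.out
    filter_upwards [h1.eventually (by simp),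
      (continuous_snd.tendsto (H.trivChart j m₀ m₀)).eventually (h2.eventually (by simp)),
      H.eventually_forall_isIsometryFamily hF hρ hj] with y hy1 hy2 hy3
    exact isKillingForm_gaugeForm (hy2.differentiableAt (by norm_num))
      (hy1.differentiableAt (by norm_num)) hy3

/-- Near `m` the fibre coordinate of `i` is the one of `j` moved by `transition j i`, so
transporting it back by the frozen `transition i j` is `gaugeMap` composed with `trivChart`. Both
sides differentiate this one map; the identity links `vertForm` to `localForm`. -/
theorem mder_extChartAt_comp_gauge {i : ι} {m : M} (hi : π m ∈ (H.triv i).baseSet)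
    (hj : π m ∈ (H.triv j).baseSet) (hB : π m ∈ (extChartAt 𝓘(ℝ, EB) (π m₀)).source)
    (hF : H.fibreCoord j m ∈ (extChartAt 𝓘(ℝ, EF) (H.fibreCoord j m₀)).source)
    (hd : MDifferentiableAt 𝓘(ℝ, EM) 𝓘(ℝ, EB × EF) (H.trivChart j m₀) m)
    (hg : DifferentiableAt ℝ (H.gaugeMap i j m₀ (H.trivChart j m₀ m).1) (H.trivChart j m₀ m)) :
    (mder (extChartAt 𝓘(ℝ, EF) (H.fibreCoord j m₀)) (H.fibreCoord j m) : EF →L[ℝ] EF) ∘L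
      (mder (fun m' ↦ H.transition i j (π m) • H.fibreCoord i m') m : EM →L[ℝ] EF) =
    fderiv ℝ (H.gaugeMap i j m₀ (H.trivChart j m₀ m).1) (H.trivChart j m₀ m) ∘L
      (mder (H.trivChart j m₀) m : EM →L[ℝ] EB × EF) := by
  have hval : H.transition i j (π m) • H.fibreCoord i m = H.fibreCoord j m :=
    (H.fibreCoord_change hi hj).symm
  have d1 : MDifferentiableAt 𝓘(ℝ, EM) 𝓘(ℝ, EF)
      (fun m' ↦ H.transition i j (π m) • H.fibreCoord i m') m :=
    ((contMDiff_const_smul (EG := EG) _).contMDiffAt.comp m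
      (H.contMDiffAt_fibreCoord hi)).mdifferentiableAt (by simp)
  have e1 := mder_comp (g := extChartAt 𝓘(ℝ, EF) (H.fibreCoord j m₀)) (E'' := EF) (by
    rw [hval]
    exact (contMDiffAt_extChartAt_of_mem hF).mdifferentiableAt (by simp)) d1
  have e2 := mder_comp (g := H.gaugeMap i j m₀ (H.trivChart j m₀ m).1) (E'' := EF)
    hg.mdifferentiableAt hd
  rw [hval] at e1
  rw [← mder_eq_fderiv, ← e1, ← e2]
  refine mder_congr ?_
  filter_upwards [H.eventually_mem_baseSet hi, H.eventually_mem_baseSet hj,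
    (H.contMDiff_proj.continuous.tendsto m).eventually
      ((isOpen_extChartAt_source (I := 𝓘(ℝ, EB)) (π m₀)).mem_nhds hB),
    (H.contMDiffAt_fibreCoord hj).continuousAt.eventually
      ((isOpen_extChartAt_source (I := 𝓘(ℝ, EF)) (H.fibreCoord j m₀)).mem_nhds hF)]
    with m' h1 h2 h3 h4
  rw [gaugeMap, gaugePoint, trivChart, trivChart]
  simp only
  rw [(extChartAt 𝓘(ℝ, EB) (π m₀)).left_inv hB, (extChartAt 𝓘(ℝ, EB) (π m₀)).left_inv h3,
    (extChartAt 𝓘(ℝ, EF) (H.fibreCoord j m₀)).left_inv h4, ← H.fibreCoord_change h2 h1]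

/-- In an adapted chart, the metric on the total space is a connection metric. -/
theorem isLocalForm_connForm (gB : RiemMetric EB B) {gF : RiemMetric EF F}
    (hF : IsInvariantMetric G gF) (hρ : H.IsAdaptedPartition ρ c)
    (hj : π m₀ ∈ (H.triv j).baseSet) (s : ℝ) :
    IsLocalForm (H.connForm ρ c gB gF s j) (H.trivChart j m₀)
      (connMetric (chartMetric gB (π m₀)) (chartMetric gF (H.fibreCoord j m₀))
        (H.localForm ρ c j m₀) s) m₀ := by
  have hc := (H.contMDiffAt_trivChart hj).continuousAt
  filter_upwards [H.eventually_mem_baseSet hj,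
    (H.contMDiff_proj.continuous.tendsto m₀).eventually
      (extChartAt_source_mem_nhds (I := 𝓘(ℝ, EB)) (π m₀)),
    (H.contMDiffAt_fibreCoord hj).continuousAt.eventually
      (extChartAt_source_mem_nhds (I := 𝓘(ℝ, EF)) (H.fibreCoord j m₀)),
    eventually_contMDiffAt (H.contMDiffAt_trivChart hj),
    hc.eventually (H.eventually_forall_isIsometryFamily hF hρ hj)] with m hmj hmB hmF hmd hiso v w
  have hΦ := hmd.mdifferentiableAt (by simp)
  have hb : (extChartAt 𝓘(ℝ, EB) (π m₀)).symm (H.trivChart j m₀ m).1 = π m :=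
    (extChartAt 𝓘(ℝ, EB) (π m₀)).left_inv hmB
  have dπ : MDifferentiableAt 𝓘(ℝ, EM) 𝓘(ℝ, EB) π m :=
    H.contMDiff_proj.contMDiffAt.mdifferentiableAt (by simp)
  have dB : MDifferentiableAt 𝓘(ℝ, EB) 𝓘(ℝ, EB) (extChartAt 𝓘(ℝ, EB) (π m₀)) (π m) :=
    (contMDiffAt_extChartAt_of_mem hmB).mdifferentiableAt (by simp)
  have dfib : MDifferentiableAt 𝓘(ℝ, EM) 𝓘(ℝ, EF) (H.fibreCoord j) m :=
    (H.contMDiffAt_fibreCoord hmj).mdifferentiableAt (by simp)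
  have dF : MDifferentiableAt 𝓘(ℝ, EF) 𝓘(ℝ, EF) (extChartAt 𝓘(ℝ, EF) (H.fibreCoord j m₀))
      (H.fibreCoord j m) := (contMDiffAt_extChartAt_of_mem hmF).mdifferentiableAt (by simp)
  have hfst (v : EM) : ((mder (H.trivChart j m₀) m : EM →L[ℝ] EB × EF) v).1 =
      (mder (extChartAt 𝓘(ℝ, EB) (π m₀)) (π m) : EB →L[ℝ] EB) ((mder π m : EM →L[ℝ] EB) v) := by
    have e1 : (mder (H.trivChart j m₀) m : EM →L[ℝ] EB × EF) = _ :=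
      mder_prodMk (dB.comp m dπ) (dF.comp m dfib)
    have e2 := mder_comp (E'' := EB) dB dπ
    rw [e1]
    exact DFunLike.congr_fun e2 v
  -- The vertical projection of the local connection form is `vertForm` read in the fibre chart,
  -- compared summand by summand.
  have hsnd (v : EM) : ((mder (H.trivChart j m₀) m : EM →L[ℝ] EB × EF) v).2 +
      H.localForm ρ c j m₀ (H.trivChart j m₀ m)
        ((mder (H.trivChart j m₀) m : EM →L[ℝ] EB × EF) v).1 =
      (mder (extChartAt 𝓘(ℝ, EF) (H.fibreCoord j m₀)) (H.fibreCoord j m) : EF →L[ℝ] EF)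
        (H.vertForm ρ c j m v) := by
    rw [localForm, ← sum_smul_fderiv_eq (by rw [hb]; exact hρ.sum_eq_one _) hiso, hb, vertForm,
      sum_apply, map_sum]
    refine Finset.sum_congr rfl fun k _ ↦ ?_
    rw [smul_apply, map_smul]
    by_cases h0 : ρ k (π m) = 0
    · rw [h0, zero_smul, zero_smul]
    congr 1
    have hk := hρ.mem_baseSet H k _ h0
    exact (DFunLike.congr_fun (H.mder_extChartAt_comp_gauge hk hmj hmB hmF hΦ
      ((hiso k (by rwa [hb])).contDiffAt.differentiableAt (by norm_num))) v).symm
  rw [connForm_apply, connMetric_apply, hsnd, hsnd, hfst, hfst,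
    metricForm_eq_chartMetric gB hmB, metricForm_eq_chartMetric gF hmF]
  rfl

/-- A trivialization over a neighbourhood of a point of the base. -/
def index (b : B) : ι := (H.cover b).choose

theorem mem_baseSet_index (b : B) : b ∈ (H.triv (H.index b)).baseSet := (H.cover b).choose_spec

variable (ρ c) in
/-- The connection metric on the total space, as a field of bilinear forms. -/
def totalForm (gB : RiemMetric EB B) (gF : RiemMetric EF F) (s : ℝ) (m : M) :
    EM →L[ℝ] EM →L[ℝ] ℝ :=
  H.connForm ρ c gB gF s (H.index (π m)) m

/-- The trivialization chosen in `totalForm` may jump from point to point; `connForm_eq` allows it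
to be replaced by the fixed `j` near `m₀`. -/
theorem isLocalForm_totalForm (gB : RiemMetric EB B) {gF : RiemMetric EF F}
    (hF : IsInvariantMetric G gF) (hρ : H.IsAdaptedPartition ρ c)
    (hj : π m₀ ∈ (H.triv j).baseSet) (s : ℝ) :
    IsLocalForm (H.totalForm ρ c gB gF s) (H.trivChart j m₀)
      (connMetric (chartMetric gB (π m₀)) (chartMetric gF (H.fibreCoord j m₀))
        (H.localForm ρ c j m₀) s) m₀ := by
  filter_upwards [H.isLocalForm_connForm gB hF hρ hj s, H.eventually_mem_baseSet hj]
    with m hm hmj v w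
  rw [totalForm, H.connForm_eq ρ c gB (hρ.mem_baseSet H) hF s (H.mem_baseSet_index (π m)) hmj]
  exact hm v w

theorem isInnerForm_totalForm [FiniteDimensional ℝ EB] [FiniteDimensional ℝ EF]
    (gB : RiemMetric EB B) {gF : RiemMetric EF F}
    (hF : IsInvariantMetric G gF) (hρ : H.IsAdaptedPartition ρ c) {s : ℝ} (hs : 0 < s) (m : M) :
    IsInnerForm (H.totalForm ρ c gB gF s m) := by
  have hj := H.mem_baseSet_index (π m)
  have hloc := (H.isLocalForm_totalForm gB hF hρ hj s).self_of_nhds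
  have hinv := (H.isInvertible_mder_trivChart hj).self_of_nhds
  have hdata := H.isConnectionData gB hF hρ hj
  have hin := isInnerForm_connMetric (ξ := H.localForm ρ c (H.index (π m)) m)
    hdata.base_inner.self_of_nhds hdata.fibre_inner.self_of_nhds hs
  refine ⟨fun v w ↦ ?_, fun v hv ↦ ?_⟩
  · rw [hloc, hloc, hin.symm]
  · rw [hloc]
    exact hin.pos _ fun h0 ↦ hv (hinv.injective (by rw [h0, map_zero]))

/-- The connection metric on the total space, with fibres scaled by `s`. -/
def totalMetric [FiniteDimensional ℝ EM] [FiniteDimensional ℝ EB] [FiniteDimensional ℝ EF]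
    (gB : RiemMetric EB B) {gF : RiemMetric EF F}
    (hF : IsInvariantMetric G gF) (hρ : H.IsAdaptedPartition ρ c) {s : ℝ} (hs : 0 < s) :
    RiemMetric EM M :=
  mkMetric (E' := EB × EF) (H.totalForm ρ c gB gF s) (H.isInnerForm_totalForm gB hF hρ hs)
    fun m ↦ ⟨_, _, H.contMDiffAt_trivChart (H.mem_baseSet_index (π m)),
      contDiffAt_connMetric (contDiffAt_chartMetric gB (π m))
        (contDiffAt_chartMetric gF (H.fibreCoord (H.index (π m)) m))
        (H.contDiffAt_localForm hρ (H.mem_baseSet_index (π m))),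
      H.isLocalForm_totalForm gB hF hρ (H.mem_baseSet_index (π m)) s⟩

/-- Locally, the connection metric has positive Ricci curvature if the fibres are small. -/
theorem eventually_ricci_totalMetric_pos [FiniteDimensional ℝ EM] [FiniteDimensional ℝ EB]
    [FiniteDimensional ℝ EF] {gB : RiemMetric EB B} (hB : HasPositiveRicci gB)
    {gF : RiemMetric EF F} (hF : IsInvariantMetric G gF) (hFpos : HasPositiveRicci gF)
    (hρ : H.IsAdaptedPartition ρ c) (m₀ : M) :
    ∃ ε > 0, ∀ᶠ m in 𝓝 m₀, ∀ s, ∀ hs : 0 < s, s < ε →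
      ∀ v : EM, v ≠ 0 → 0 < ricci (H.totalMetric gB hF hρ hs) m v v := by
  have hj := H.mem_baseSet_index (π m₀)
  set j := H.index (π m₀)
  have hdata := H.isConnectionData gB hF hρ hj
  obtain ⟨ε, hε, hpos⟩ := coordRicci_connMetric_pos hdata
    (coordRicci_chartMetric_pos gB hB (π m₀))
    (coordRicci_chartMetric_pos gF hFpos (H.fibreCoord j m₀))
  refine ⟨ε, hε, ?_⟩
  have hc := (H.contMDiffAt_trivChart hj).continuousAt
  have hloc : ∀ᶠ m in 𝓝 m₀, ∀ᶠ m' in 𝓝 m, ∀ s v w, H.totalForm ρ c gB gF s m' v w =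
      connMetric (chartMetric gB (π m₀)) (chartMetric gF (H.fibreCoord j m₀))
        (H.localForm ρ c j m₀) s (H.trivChart j m₀ m')
        ((mder (H.trivChart j m₀) m' : EM →L[ℝ] EB × EF) v)
        ((mder (H.trivChart j m₀) m' : EM →L[ℝ] EB × EF) w) := by
    rw [eventually_eventually_nhds]
    -- The neighbourhood must not depend on `s`. Both forms are affine in `s`, so agreement at `s =
    -- 0` and `s = 1` on one neighbourhood gives agreement for all `s`.
    have h0 := H.isLocalForm_totalForm gB hF hρ hj 0
    have h1 := H.isLocalForm_totalForm gB hF hρ hj 1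
    filter_upwards [h0, h1] with m e0 e1 s v w
    have a0 := e0 v w
    have a1 := e1 v w
    rw [totalForm, connForm_apply, connMetric_apply] at *
    linear_combination (1 - s) * a0 + s * a1
  filter_upwards [hloc, hc.eventually hpos, H.isInvertible_mder_trivChart hj,
    hc.eventually hdata.eventually, eventually_contMDiffAt (H.contMDiffAt_trivChart hj)]
    with m hm hmpos hinv hmdata hsm s hs hsε v hv
  have hin : ∀ᶠ z in 𝓝 (H.trivChart j m₀ m),
      IsInnerForm (connMetric (chartMetric gB (π m₀)) (chartMetric gF (H.fibreCoord j m₀))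
        (H.localForm ρ c j m₀) s z) :=
    hmdata.eventually.mono fun z hz ↦ isInnerForm_connMetric hz.base_inner.self_of_nhds
      hz.fibre_inner.self_of_nhds hs
  rw [ricci_eq_of_isLocalForm (H.totalMetric gB hF hρ hs) hsm hinv
    (hm.mono fun m' h v w ↦ h s v w)
    ((contDiffAt_connMetric hmdata.base hmdata.fibre hmdata.form).of_le (by norm_num)) hin]
  exact hmpos s hs hsε _ fun h0 ↦ hv (hinv.injective (by rw [h0, map_zero]))

theorem exists_hasPositiveRicci [FiniteDimensional ℝ EM] [FiniteDimensional ℝ EB]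
    [FiniteDimensional ℝ EF] [CompactSpace M] {gB : RiemMetric EB B} (hB : HasPositiveRicci gB)
    {gF : RiemMetric EF F} (hF : IsInvariantMetric G gF) (hFpos : HasPositiveRicci gF)
    (hρ : H.IsAdaptedPartition ρ c) : ∃ g : RiemMetric EM M, HasPositiveRicci g := by
  have key : ∃ ε > 0, ∀ m ∈ (Set.univ : Set M), ∀ s, ∀ hs : 0 < s, s < ε →
      ∀ v : EM, v ≠ 0 → 0 < ricci (H.totalMetric gB hF hρ hs) m v v := by
    -- Having a uniform bound `ε` passes to subsets and, by taking minima, to finite unions; it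
    -- holds near each point, hence on all of `M`.
    refine isCompact_univ.induction_on (p := fun S : Set M ↦ ∃ ε > 0, ∀ m ∈ S, ∀ s,
      ∀ hs : 0 < s, s < ε → ∀ v : EM, v ≠ 0 → 0 < ricci (H.totalMetric gB hF hρ hs) m v v)
      ⟨1, one_pos, by simp⟩ ?_ ?_ ?_
    · rintro S T hST ⟨ε, hε, h⟩
      exact ⟨ε, hε, fun m hm ↦ h m (hST hm)⟩
    · rintro S T ⟨ε, hε, h⟩ ⟨ε', hε', h'⟩
      refine ⟨min ε ε', lt_min hε hε', fun m hm s hs hsε ↦ ?_⟩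
      rcases hm with hm | hm
      · exact h m hm s hs (hsε.trans_le (min_le_left _ _))
      · exact h' m hm s hs (hsε.trans_le (min_le_right _ _))
    · intro m _
      obtain ⟨ε, hε, h⟩ := H.eventually_ricci_totalMetric_pos hB hF hFpos hρ m
      exact ⟨_, mem_nhdsWithin_of_mem_nhds h, ε, hε, fun m' hm' ↦ hm'⟩
  obtain ⟨ε, hε, h⟩ := key
  exact ⟨H.totalMetric gB hF hρ (half_pos hε), fun m v hv ↦
    h m trivial _ (half_pos hε) (half_lt_self hε) v hv⟩

/-- A point of the total space yields a point of `F`, so no fibre over `B` is empty. -/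
theorem surjective_proj [Nonempty M] (H : FiberBundleWithGroup EM EB EF EG F G ι π) :
    Function.Surjective π := by
  intro b
  obtain ⟨m⟩ := ‹Nonempty M›
  obtain ⟨i, hi⟩ := H.cover b
  exact ⟨(H.triv i).toOpenPartialHomeomorph.symm (b, H.fibreCoord i m),
    (H.triv i).proj_symm_apply' hi⟩

theorem exists_isAdaptedPartition [FiniteDimensional ℝ EB] [CompactSpace B] [T2Space B] :
    ∃ (t : Finset ι) (ρ : t → B → ℝ), H.IsAdaptedPartition ρ (fun k ↦ (k : ι)) := by
  -- A finite subcover comes first, because the averages are sums over a finite index type.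
  obtain ⟨t, ht⟩ := isCompact_univ.elim_finite_subcover (fun i ↦ (H.triv i).baseSet)
    (fun i ↦ (H.triv i).open_baseSet) (fun b _ ↦ Set.mem_iUnion.2 (H.cover b))
  obtain ⟨f, hf⟩ := SmoothPartitionOfUnity.exists_isSubordinate 𝓘(ℝ, EB) isClosed_univ
    (fun k : t ↦ (H.triv k).baseSet) (fun k ↦ (H.triv k).open_baseSet) (fun b hb ↦ by
      obtain ⟨i, hi, hbi⟩ := Set.mem_iUnion₂.1 (ht hb)
      exact Set.mem_iUnion.2 ⟨⟨i, hi⟩, hbi⟩)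
  refine ⟨t, fun k b ↦ f k b, fun k ↦ (f k).contMDiff, fun k b hb ↦ ?_, fun b ↦ ?_⟩
  · have h1 : b ∉ tsupport (f k) := fun h ↦ hb (hf k h)
    exact notMem_tsupport_iff_eventuallyEq.1 h1
  · rw [← finsum_eq_sum_of_fintype]
    exact f.sum_eq_one (Set.mem_univ b)

end FiberBundleWithGroup

end PosRicci

end

theorem mainTheorem2
    {EM EB EF EG : Type*}
    [NormedAddCommGroup EM] [NormedSpace ℝ EM] [FiniteDimensional ℝ EM]
    [NormedAddCommGroup EB] [NormedSpace ℝ EB] [FiniteDimensional ℝ EB]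
    [NormedAddCommGroup EF] [NormedSpace ℝ EF] [FiniteDimensional ℝ EF]
    [NormedAddCommGroup EG] [NormedSpace ℝ EG] [FiniteDimensional ℝ EG]
    {M B F G ι : Type*}
    [TopologicalSpace M] [ChartedSpace EM M] [IsManifold 𝓘(ℝ, EM) ∞ M] [T2Space M]
    [TopologicalSpace B] [ChartedSpace EB B] [IsManifold 𝓘(ℝ, EB) ∞ B] [T2Space B]
    [TopologicalSpace F] [ChartedSpace EF F] [IsManifold 𝓘(ℝ, EF) ∞ F] [T2Space F]
    [TopologicalSpace G] [ChartedSpace EG G] [Group G] [LieGroup 𝓘(ℝ, EG) ∞ G]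
    [MulAction G F] [ContMDiffSMul 𝓘(ℝ, EG) 𝓘(ℝ, EF) ∞ G F]
    [CompactSpace M] [ConnectedSpace M]
    (π : M → B) (hbundle : PosRicci.FiberBundleWithGroup EM EB EF EG F G ι π)
    (hB : ∃ gB : PosRicci.RiemMetric EB B, PosRicci.HasPositiveRicci gB)
    (hF : ∃ gF : PosRicci.RiemMetric EF F,
      PosRicci.IsInvariantMetric G gF ∧ PosRicci.HasPositiveRicci gF) :
    ∃ g : PosRicci.RiemMetric EM M, PosRicci.HasPositiveRicci g := by
  obtain ⟨gB, hgB⟩ := hB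
  obtain ⟨gF, hinv, hgF⟩ := hF
  -- The base is the continuous image of the compact space `M`, which is nonempty because it is
  -- connected.
  have : CompactSpace B := hbundle.surjective_proj.compactSpace
    hbundle.contMDiff_proj.continuous
  obtain ⟨t, ρ, hρ⟩ := hbundle.exists_isAdaptedPartition
  exact hbundle.exists_hasPositiveRicci hgB hinv hgF hρ
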